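/- **Setting.** A *base game* consists of a finite set $I$ of players, a finite set $\Theta$ of payoff states with a full-support prior $\pi\in\Delta(\Theta)$, and for each player $i$ a finite action set $A_i$ and a utility $u_i:A\times\Theta\to\mathbb R$, where $A=\prod_i A_i$ and $A_{-i}=\prod_{j\ne i}A_j$. An *outcome* is a probability distribution $p$ on $A\times\Theta$ whose marginal on $\Theta$ is $\pi$. Write $p(a_i)=\sum_{a_{-i},\theta}p(a_i,a_{-i},\theta)$, $\mathrm{supp}_i(p)=\{a_i:p(a_i)>0\}$, and, for $a_i\in\mathrm{supp}_i(p)$, $p_{a_i}(a_{-i},\theta)=p(a_i,a_{-i},\theta)/p(a_i)$. For a distribution $\mu$ on $A_{-i}\times\Theta$ let $BR(\mu)=\arg\max_{b_i\in A_i}\sum_{a_{-i},\theta}u_i(b_i,a_{-i},\theta)\mu(a_{-i},\theta)$. **Separated BCE.** An outcome $p$ is a *Bayes correlated equilibrium* (BCE) if $\sum_{a_{-i},\theta}\big(u_i(a_i,a_{-i},\theta)-u_i(b_i,a_{-i},\theta)\big)p(a_i,a_{-i},\theta)\ge 0$ for all $i$ and $a_i,b_i\in A_i$. It is *separated* if moreover,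 for all $i$ and $a_i,b_i\in\mathrm{supp}_i(p)$, $p_{a_i}\neq p_{b_i}$ implies $BR(p_{a_i})\cap BR(p_{b_i})=\varnothing$. **Complete-information Nash equilibrium.** An outcome $p$ such that for every $\theta$ there is a mixed action profile $(\alpha_{\theta,i})_{i\in I}$ with $p(a,\theta)/\pi(\theta)=\prod_i\alpha_{\theta,i}(a_i)$ for all $a$, and with $\alpha_{\theta,i}$ maximizing $\sum_a u_i(a,\theta)\beta_i(a_i)\prod_{j\ne i}\alpha_{\theta,j}(a_j)$ over $\beta_i\in\Delta(A_i)$ for all $i$. **Information acquisition.** An *information technology* consists of a finite set $Z$, a kernel $\zeta:\Theta\to\Delta(Z)$ and, for each $i$, a finite signal set $X_i$ with more elements than $A_i$ and than $Z\times\Theta$, a set $\mathcal E_i$ of feasible experiments $\xi_i:Z\times\Theta\to\Delta(X_i)$, and a cost $C_i:\mathcal E_i\to\mathbb R_+$ that is zero at some feasible experiment. In the induced game each player $i$ chooses $\xi_i\in\mathcal E_i$ and a plan $\sigma_i:X_i\to\Delta(A_i)$; an *equilibrium* is a profile $(\xi^*,\sigma^*)$ such that for each $i$, $(\xi_i^*,\sigma_i^*)$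 maximizes $$\sum_{a,x,z,\theta}u_i(a,\theta)\,\sigma_i(a_i|x_i)\,\xi_i(x_i|z,\theta)\prod_{j\ne i}\sigma^*_j(a_j|x_j)\,\xi^*_j(x_j|z,\theta)\,\zeta(z|\theta)\,\pi(\theta)-C_i(\xi_i).$$ Its outcome is $q(a,\theta)=\sum_{x,z}\prod_i\sigma^*_i(a_i|x_i)\xi^*_i(x_i|z,\theta)\,\zeta(z|\theta)\pi(\theta)$. Write $\xi_i\succsim\xi_i'$ if there is a kernel $g:X_i\to\Delta(X_i)$ with $\xi_i'(x_i|z,\theta)=\sum_{x_i'}g(x_i|x_i')\xi_i(x_i'|z,\theta)$ for all $x_i$ and all $(z,\theta)$ with $\zeta(z|\theta)>0$. The cost $C_i$ is *monotone* if for all $\xi_i,\xi_i'\in\mathcal E_i$, $\xi_i\succsim\xi_i'$ implies $C_i(\xi_i)\ge C_i(\xi_i')$, strictly if also $\xi_i'\not\succsim\xi_i$. The technology represents *unconstrained rational inattention* if, for every $i$, all experiments are feasible and $C_i$ is monotone. **Vanishing cost equilibrium.** An outcome $p$ such that for every $\epsilon>0$ there are an unconstrained rational-inattention technology and an equilibrium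 of the induced game with outcome $q$ such that $\max C_i(\mathcal E_i)\le\epsilon$ and $|p(a,\theta)-q(a,\theta)|\le\epsilon$ for all $i$, $a$, $\theta$. **Product partitions.** A product partition $\mathcal A$ of $A$ is given by a partition $\mathcal A_i$ of $A_i$ for each $i$ (its cells are the products of cells). For an outcome $p$, $\mathcal A^p$ is the product partition for which $a_i,b_i$ lie in the same cell iff either $a_i,b_i\in\mathrm{supp}_i(p)$ and $p_{a_i}=p_{b_i}$, or $a_i,b_i\notin\mathrm{supp}_i(p)$. An outcome $q$ is *$(\mathcal A,p)$-decomposable* if for all $i$ and all $a_i,b_i$ in the same cell of $\mathcal A_i$: $q_{a_i}=q_{b_i}$ whenever $a_i,b_i\in\mathrm{supp}_i(q)$, and $q(a_i)p(b_i)=p(a_i)q(b_i)$. **Theorem.** Fix a base game. An outcome $p$ is a vanishing cost equilibrium if and only if there exists a product partition $\mathcal A$ of $A$ such that (i) $p$ is a convex combination of finitely many $(\mathcal A,p)$-decomposable complete-information Nash equilibria, and (ii) $p$ is the limit of a sequence $(p^n)_{n=1}^\infty$ of separated BCEs with $\mathcal A^{p^n}=\mathcal A$ for all $n$. -/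

import Mathlib

open scoped BigOperators Topology

noncomputable section

namespace InfoGame

universe uI uT uA

/-- A base game with player set `I`, payoff states `Θ` and action sets `A i`: a full-support prior
on the payoff states and a utility function for each player. -/
structure BaseGame (I : Type uI) (Θ : Type uT) [Fintype Θ] (A : I → Type uA) where
  /-- the prior -/
  prior : Θ → ℝ
  prior_pos : ∀ θ, 0 < prior θ
  prior_sum : ∑ θ, prior θ = 1
  /-- the utility functions -/
  u : I → (∀ j, A j) → Θ → ℝ

/-- Action profiles of the players other than `i`. -/
abbrev Others {I : Type uI} (A : I → Type uA) (i : I) : Type (max uI uA) :=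
  ∀ j : {j : I // j ≠ i}, A j

/-- A product partition of the set of action profiles, given by a partition of each `A i`;
a partition is encoded by its equivalence relation "lying in the same cell". -/
abbrev ProductPartition {I : Type uI} (A : I → Type uA) : Type (max uI uA) :=
  ∀ i, Setoid (A i)

section Defs

variable {I : Type uI} {Θ : Type uT} {A : I → Type uA}
variable [Fintype I] [DecidableEq I] [Fintype Θ] [∀ i, Fintype (A i)]

/-- The action profile `(a_i, a_{-i})`. -/
def combine (i : I) (x : A i) (y : Others A i) : ∀ j, A j :=
  (Equiv.piSplitAt i A).symm (x, y)

/-- The probability `p(a_i)` that player `i` takes action `x`. -/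
def actionProb (p : (∀ j, A j) × Θ → ℝ) (i : I) (x : A i) : ℝ :=
  ∑ y : Others A i, ∑ θ, p (combine i x y, θ)

/-- The actions of player `i` that have positive probability. -/
def suppAct (p : (∀ j, A j) × Θ → ℝ) (i : I) : Set (A i) :=
  {x | 0 < actionProb p i x}

/-- The conditional distribution of the others' actions and the payoff state given that player `i`
takes action `x` (used only for `x ∈ suppAct p i`). -/
def cond (p : (∀ j, A j) × Θ → ℝ) (i : I) (x : A i) : Others A i × Θ → ℝ :=
  fun yθ => p (combine i x yθ.1, yθ.2) / actionProb p i x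

/-- The product partition generated by `p`: two actions of player `i` lie in the same cell iff both
have positive probability and induce the same conditional distribution, or both have probability
zero. -/
def inducedPartition (p : (∀ j, A j) × Θ → ℝ) : ProductPartition A := fun i =>
  { r := fun x x' => (x ∈ suppAct p i ∧ x' ∈ suppAct p i ∧ cond p i x = cond p i x') ∨
      (x ∉ suppAct p i ∧ x' ∉ suppAct p i)
    iseqv := by
      refine ⟨fun x => ?_, fun {x y} h => ?_, fun {x y z} h h' => ?_⟩
      · by_cases hx : x ∈ suppAct p i
        · exact Or.inl ⟨hx, hx, rfl⟩
        · exact Or.inr ⟨hx, hx⟩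
      · rcases h with ⟨h1, h2, h3⟩ | ⟨h1, h2⟩
        · exact Or.inl ⟨h2, h1, h3.symm⟩
        · exact Or.inr ⟨h2, h1⟩
      · rcases h with ⟨h1, h2, h3⟩ | ⟨h1, h2⟩ <;> rcases h' with ⟨k1, k2, k3⟩ | ⟨k1, k2⟩
        · exact Or.inl ⟨h1, k2, h3.trans k3⟩
        · exact absurd h2 k1
        · exact absurd k1 h2
        · exact Or.inr ⟨h1, k2⟩ }

/-- `q` is measurable with respect to the product partition `P`: positive-probability actions in
the same cell induce the same conditional distribution. -/
def IsMeasurableFor (P : ProductPartition A) (q : (∀ j, A j) × Θ → ℝ) : Prop :=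
  ∀ i, ∀ x x' : A i, P i x x' → x ∈ suppAct q i → x' ∈ suppAct q i → cond q i x = cond q i x'

/-- `q` is `(P, p)`-decomposable. -/
def IsDecomposable (P : ProductPartition A) (p q : (∀ j, A j) × Θ → ℝ) : Prop :=
  IsMeasurableFor P q ∧
    ∀ i, ∀ x x' : A i, P i x x' →
      actionProb q i x * actionProb p i x' = actionProb p i x * actionProb q i x'

/-- The outcomes of a base game: the probability distributions over action profiles and payoff
states whose marginal on the payoff states is the prior. -/
def BaseGame.outcomes (G : BaseGame I Θ A) : Set ((∀ j, A j) × Θ → ℝ) :=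
  {p | p ∈ stdSimplex ℝ ((∀ j, A j) × Θ) ∧ ∀ θ, ∑ a, p (a, θ) = G.prior θ}

/-- Player `i`'s best responses to a belief about the others' actions and the payoff state. -/
def BaseGame.bestResponses (G : BaseGame I Θ A) (i : I) (μ : Others A i × Θ → ℝ) : Set (A i) :=
  {x | ∀ x' : A i,
    ∑ y : Others A i, ∑ θ, G.u i (combine i x' y) θ * μ (y, θ) ≤
      ∑ y : Others A i, ∑ θ, G.u i (combine i x y) θ * μ (y, θ)}

/-- Bayes correlated equilibria: outcomes that satisfy the obedience constraint. -/
def BaseGame.IsBCE (G : BaseGame I Θ A) (p : (∀ j, A j) × Θ → ℝ) : Prop :=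
  p ∈ G.outcomes ∧
    ∀ i, ∀ x x' : A i,
      0 ≤ ∑ y : Others A i, ∑ θ,
        (G.u i (combine i x y) θ - G.u i (combine i x' y) θ) * p (combine i x y, θ)

/-- Separated Bayes correlated equilibria: positive-probability actions with distinct conditional
distributions have disjoint sets of best responses. -/
def BaseGame.IsSeparatedBCE (G : BaseGame I Θ A) (p : (∀ j, A j) × Θ → ℝ) : Prop :=
  G.IsBCE p ∧
    ∀ i, ∀ x ∈ suppAct p i, ∀ x' ∈ suppAct p i, cond p i x ≠ cond p i x' →
      G.bestResponses i (cond p i x) ∩ G.bestResponses i (cond p i x') = ∅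

/-- Complete-information Nash equilibria: outcomes under which, conditional on each payoff state,
the players play a mixed Nash equilibrium of the complete-information game at that state. -/
def BaseGame.IsCompleteInfoNash (G : BaseGame I Θ A) (p : (∀ j, A j) × Θ → ℝ) : Prop :=
  p ∈ G.outcomes ∧
    ∀ θ, ∃ α : ∀ i, stdSimplex ℝ (A i),
      (∀ a, p (a, θ) / G.prior θ = ∏ i, α i (a i)) ∧
      ∀ i, ∀ β : stdSimplex ℝ (A i),
        ∑ a, G.u i a θ * β (a i) * ∏ j ∈ Finset.univ.erase i, α j (a j) ≤
          ∑ a, G.u i a θ * α i (a i) * ∏ j ∈ Finset.univ.erase i, α j (a j)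

end Defs

/-- An information technology: a finite set `Z` of correlation states drawn according to a kernel
`ζ`, and for each player `i` a finite set `X i` of signals (with more elements than `A i` and than
`Z × Θ`), a set `feasible i` of feasible experiments and a cost function, of which only the values
on feasible experiments matter, and which vanishes at some feasible experiment. An experiment is a
Markov kernel from `Z × Θ` to `X i`. -/
structure Technology {I : Type uI} (Θ : Type uT) [Fintype Θ] (A : I → Type uA)
    [∀ i, Fintype (A i)] where
  Z : Type
  X : I → Type
  [fintypeZ : Fintype Z]
  [fintypeX : ∀ i, Fintype (X i)]
  ζ : Θ → stdSimplex ℝ Z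
  feasible : ∀ i, Set (Z × Θ → stdSimplex ℝ (X i))
  cost : ∀ i, (Z × Θ → stdSimplex ℝ (X i)) → ℝ
  card_action_lt : ∀ i, Fintype.card (A i) < Fintype.card (X i)
  card_state_lt : ∀ i, Fintype.card (Z × Θ) < Fintype.card (X i)
  cost_nonneg : ∀ i, ∀ ξ ∈ feasible i, 0 ≤ cost i ξ
  exists_cost_zero : ∀ i, ∃ ξ ∈ feasible i, cost i ξ = 0

attribute [instance] Technology.fintypeZ Technology.fintypeX

section Games

variable {I : Type uI} {Θ : Type uT} {A : I → Type uA}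
variable [Fintype I] [DecidableEq I] [Fintype Θ] [∀ i, Fintype (A i)]

/-- The experiments of player `i`, feasible or not. -/
abbrev Technology.Experiment (T : Technology Θ A) (i : I) : Type uT :=
  T.Z × Θ → stdSimplex ℝ (T.X i)

/-- The action plans of player `i`. -/
abbrev Technology.Plan (T : Technology Θ A) (i : I) : Type uA :=
  T.X i → stdSimplex ℝ (A i)

/-- The experiment `ξ` Blackwell dominates the experiment `ξ'`. -/
def Technology.Dominates (T : Technology Θ A) (i : I) (ξ ξ' : T.Experiment i) : Prop :=
  ∃ g : T.X i → stdSimplex ℝ (T.X i), ∀ x θ z, 0 < T.ζ θ z →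
    ξ' (z, θ) x = ∑ x', g x' x * ξ (z, θ) x'

/-- The cost function of player `i` is monotone in the Blackwell order, strictly so on strictly
ranked experiments. -/
def Technology.IsMonotone (T : Technology Θ A) (i : I) : Prop :=
  ∀ ξ ∈ T.feasible i, ∀ ξ' ∈ T.feasible i, T.Dominates i ξ ξ' →
    T.cost i ξ' ≤ T.cost i ξ ∧ (¬ T.Dominates i ξ' ξ → T.cost i ξ' < T.cost i ξ)

/-- Unconstrained rational inattention: all experiments are feasible and costs are monotone. -/
def Technology.IsUnconstrainedRI (T : Technology Θ A) : Prop :=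
  ∀ i, T.feasible i = Set.univ ∧ T.IsMonotone i

/-- Player `i`'s payoff from the experiment `ξi` and the action plan `σi` when the other players
follow `ξ` and `σ` (the `i`-th components of which play no role). -/
def payoff (G : BaseGame I Θ A) (T : Technology Θ A) (i : I) (ξi : T.Experiment i) (σi : T.Plan i)
    (ξ : ∀ j, T.Experiment j) (σ : ∀ j, T.Plan j) : ℝ :=
  (∑ a : ∀ j, A j, ∑ x : ∀ j, T.X j, ∑ z, ∑ θ,
    G.u i a θ * (σi (x i) (a i) * ξi (z, θ) (x i)) *
      (∏ j ∈ Finset.univ.erase i, σ j (x j) (a j) * ξ j (z, θ) (x j)) *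
      T.ζ θ z * G.prior θ) - T.cost i ξi

/-- Nash equilibria of the information acquisition game. -/
def IsEquilibrium (G : BaseGame I Θ A) (T : Technology Θ A)
    (ξ : ∀ j, T.Experiment j) (σ : ∀ j, T.Plan j) : Prop :=
  ∀ i, ξ i ∈ T.feasible i ∧
    ∀ ξi ∈ T.feasible i, ∀ σi : T.Plan i,
      payoff G T i ξi σi ξ σ ≤ payoff G T i (ξ i) (σ i) ξ σ

/-- The outcome of a strategy profile: the joint distribution of actions and payoff state. -/
def outcomeOf (G : BaseGame I Θ A) (T : Technology Θ A)
    (ξ : ∀ j, T.Experiment j) (σ : ∀ j, T.Plan j) : (∀ j, A j) × Θ → ℝ :=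
  fun aθ => ∑ x : ∀ j, T.X j, ∑ z,
    (∏ j, σ j (x j) (aθ.1 j) * ξ j (z, aθ.2) (x j)) * T.ζ aθ.2 z * G.prior aθ.2

/-- Vanishing cost equilibria: outcomes that can be approximated by outcomes of equilibria of
unconstrained rational-inattention games in which all experiments have arbitrarily small cost. -/
def BaseGame.IsVanishingCostEquilibrium (G : BaseGame I Θ A) (p : (∀ j, A j) × Θ → ℝ) : Prop :=
  p ∈ G.outcomes ∧
    ∀ ε : ℝ, 0 < ε → ∃ T : Technology Θ A, T.IsUnconstrainedRI ∧
      ∃ (ξ : ∀ j, T.Experiment j) (σ : ∀ j, T.Plan j), IsEquilibrium G T ξ σ ∧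
        (∀ i, ∀ ξi ∈ T.feasible i, T.cost i ξi ≤ ε) ∧
        ∀ a θ, |p (a, θ) - outcomeOf G T ξ σ (a, θ)| ≤ ε

end Games

end InfoGame

end

noncomputable section

namespace InfoGame

universe uI uT uA

variable {I : Type uI} {Θ : Type uT} {A : I → Type uA}
variable [Fintype I] [DecidableEq I] [Fintype Θ] [∀ i, Fintype (A i)]

/-! ### Action profiles and mixed action profiles -/

/-! The bridge between the two sides is `IsDecomposition`: given a correlation state `z` and the
payoff state `θ`, players mix independently, actions with equal conditionals are played in
proportions that do not depend on `(z, θ)`, and expected regret against the realized `(z, θ)` is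
small.

From equilibria to mixtures. Merging two recommendations that share a best response, and then
playing that response, leaves gross payoffs unchanged. The merged experiment therefore cannot be
cheaper, and strict monotonicity of the cost makes the merger lossless: both recommendations carry
the same posterior on `(z, θ)`. This yields separation and proportionality
(`IsEquilibrium.proportional`). Since learning `(z, θ)` exactly costs at most `ε`, equilibrium
regret is at most `ε`. There are finitely many product partitions, so one recurs along a
subsequence. As `ε → 0`, Carathéodory compactness turns the decompositions into a finite mixture of
profiles with zero regret, i.e. Nash equilibria, which inherit the cell proportions of `p`
(`exists_isNashMixture_of_tendsto`).

From mixtures to equilibria. A separated BCE `q` close to `p` is written as `(1 - δ) p` plus a small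
nonnegative remainder: `z` names either a Nash component of `p` or an action profile drawn from the
remainder. Every player then redraws the action within its cell according to `q`. By detailed
balance this leaves `q` unchanged; it creates exact proportionality, and barely moves the Nash
components because they already have nearly those proportions
(`IsNashMixture.eventually_isDecomposition`).

It remains to find costs that make such a `q` optimal (`exists_cost`). Start from the convex
function of the posterior given by the maximum over actions of expected utility, and perturb it by a
small multiple of the squared distance to the posterior at which the action is a best response.
Separation makes that posterior unique. The resulting posterior-separable cost is strictly monotone,
bounds the value of every experiment from above, and is tight at `q`. A monotone rescaling brings
its range into `[0, ε]`. -/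

@[simp] lemma combine_self (i : I) (x : A i) (y : Others A i) : combine i x y i = x := by
  simp [combine, Equiv.piSplitAt]

@[simp] lemma combine_coe (i : I) (x : A i) (y : Others A i) (j : {j : I // j ≠ i}) :
    combine i x y j = y j := by
  simp [combine, Equiv.piSplitAt, j.2]

lemma sum_eq_sum_combine (i : I) (F : (∀ j, A j) → ℝ) :
    ∑ a, F a = ∑ x : A i, ∑ y : Others A i, F (combine i x y) := by
  rw [← Fintype.sum_prod_type', ← (Equiv.piSplitAt i A).symm.sum_comp]
  rfl

lemma prod_erase_combine (i : I) (x : A i) (y : Others A i) (f : ∀ j, A j → ℝ) :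
    ∏ j ∈ Finset.univ.erase i, f j (combine i x y j) = ∏ j : {j // j ≠ i}, f j (y j) := by
  have h := Finset.prod_subtype (p := fun j => j ≠ i) (F := inferInstance)
    (Finset.univ.erase i) (by simp)
    fun j => f j (combine i x y j)
  simpa using h

lemma prod_combine (i : I) (x : A i) (y : Others A i) (f : ∀ j, A j → ℝ) :
    ∏ j, f j (combine i x y j) = f i x * ∏ j : {j // j ≠ i}, f j (y j) := by
  rw [← Finset.mul_prod_erase _ _ (Finset.mem_univ i), prod_erase_combine, combine_self]

lemma sum_prod_others (i : I) (α : ∀ j, stdSimplex ℝ (A j)) :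
    ∑ y : Others A i, ∏ j : {j // j ≠ i}, α j (y j) = 1 := by
  have h := Finset.prod_univ_sum (fun j : {j // j ≠ i} => (Finset.univ : Finset (A j)))
    (fun j x => α j x)
  rw [Fintype.piFinset_univ] at h
  rw [← h]
  simp

lemma sum_prod_profile (α : ∀ j, stdSimplex ℝ (A j)) : ∑ a : ∀ j, A j, ∏ j, α j (a j) = 1 := by
  have h := Finset.prod_univ_sum (fun j => (Finset.univ : Finset (A j))) (fun j x => α j x)
  rw [Fintype.piFinset_univ] at h
  rw [← h]
  simp

/-! ### Regret at a payoff state, and mixtures over correlation states. -/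

namespace BaseGame

variable (G : BaseGame I Θ A)

/-- The expected payoff of player `i` at the payoff state `θ` from the action `b` when the others
play the mixed actions `α`. -/
def actionValue (i : I) (α : ∀ j, A j → ℝ) (θ : Θ) (b : A i) : ℝ :=
  ∑ y : Others A i, G.u i (combine i b y) θ * ∏ j : {j // j ≠ i}, α j (y j)

/-- The loss of player `i` at the payoff state `θ` from not best responding under `α`. -/
def regret (i : I) (α : ∀ j, A j → ℝ) (θ : Θ) : ℝ :=
  (⨆ b, G.actionValue i α θ b) - ∑ b, α i b * G.actionValue i α θ b

lemma sum_payoff_eq_sum_actionValue (i : I) (β : A i → ℝ) (α : ∀ j, A j → ℝ) (θ : Θ) :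
    ∑ a, G.u i a θ * β (a i) * ∏ j ∈ Finset.univ.erase i, α j (a j) =
      ∑ b, β b * G.actionValue i α θ b := by
  rw [sum_eq_sum_combine i]
  refine Finset.sum_congr rfl fun b _ => ?_
  rw [actionValue, Finset.mul_sum]
  refine Finset.sum_congr rfl fun y _ => ?_
  rw [prod_erase_combine, combine_self]
  ring

lemma actionValue_le_iSup (i : I) (α : ∀ j, A j → ℝ) (θ : Θ) (b : A i) :
    G.actionValue i α θ b ≤ ⨆ b, G.actionValue i α θ b :=
  le_ciSup (Set.finite_range _).bddAbove b

lemma sum_mul_actionValue_le (i : I) (β : stdSimplex ℝ (A i)) (α : ∀ j, A j → ℝ) (θ : Θ) :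
    ∑ b, β b * G.actionValue i α θ b ≤ ⨆ b, G.actionValue i α θ b := by
  calc ∑ b, β b * G.actionValue i α θ b
      ≤ ∑ b, β b * ⨆ b, G.actionValue i α θ b := Finset.sum_le_sum fun b _ =>
        mul_le_mul_of_nonneg_left (G.actionValue_le_iSup i α θ b) (stdSimplex.zero_le _ _)
    _ = _ := by rw [← Finset.sum_mul, stdSimplex.sum_eq_one, one_mul]

lemma regret_nonneg (i : I) (α : ∀ j, stdSimplex ℝ (A j)) (θ : Θ) :
    0 ≤ G.regret i (fun j => α j) θ :=
  sub_nonneg.2 (G.sum_mul_actionValue_le i (α i) _ θ)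

lemma exists_actionValue_eq_iSup (i : I) [Nonempty (A i)] (α : ∀ j, A j → ℝ) (θ : Θ) :
    ∃ b, G.actionValue i α θ b = ⨆ b, G.actionValue i α θ b :=
  exists_eq_ciSup_of_finite

/-- A linear payoff is maximized at a vertex of the simplex, so pure deviations suffice. This makes
Nash equilibrium the zero set of a continuous nonnegative function, which is the form that passes to
limits. -/
lemma regret_eq_zero_iff (i : I) (α : ∀ j, stdSimplex ℝ (A j)) (θ : Θ) :
    G.regret i (fun j => α j) θ = 0 ↔ ∀ β : stdSimplex ℝ (A i),
      ∑ a, G.u i a θ * β (a i) * ∏ j ∈ Finset.univ.erase i, α j (a j) ≤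
        ∑ a, G.u i a θ * α i (a i) * ∏ j ∈ Finset.univ.erase i, α j (a j) := by
  classical
  have hne : Nonempty (A i) := by
    by_contra h
    rw [not_nonempty_iff] at h
    have := stdSimplex.sum_eq_one (α i)
    simp at this
  simp_rw [fun β : stdSimplex ℝ (A i) =>
    G.sum_payoff_eq_sum_actionValue i β (fun j => α j) θ]
  constructor
  · intro h β
    rw [regret, sub_eq_zero] at h
    rw [← h]
    exact G.sum_mul_actionValue_le i β _ θ
  · intro h
    refine le_antisymm ?_ (G.regret_nonneg i α θ)
    obtain ⟨b, hb⟩ := G.exists_actionValue_eq_iSup i (fun j => α j) θ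
    have := h (stdSimplex.vertex b)
    rw [regret, ← hb, sub_nonpos]
    simpa [Pi.single_apply] using this

lemma continuous_actionValue (i : I) (θ : Θ) (b : A i) :
    Continuous fun α : ∀ j, A j → ℝ => G.actionValue i α θ b := by
  unfold actionValue
  fun_prop

lemma continuous_regret (i : I) (θ : Θ) :
    Continuous fun α : ∀ j, A j → ℝ => G.regret i α θ := by
  cases isEmpty_or_nonempty (A i) with
  | inl h => simpa [regret, Real.iSup_of_isEmpty] using continuous_const
  | inr h =>
    have hsup : Continuous fun α : ∀ j, A j → ℝ => ⨆ b, G.actionValue i α θ b := by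
      have : (fun α : ∀ j, A j → ℝ => ⨆ b, G.actionValue i α θ b) =
          fun α => Finset.univ.sup' Finset.univ_nonempty fun b => G.actionValue i α θ b := by
        funext α
        rw [Finset.sup'_univ_eq_ciSup]
      rw [this]
      exact Continuous.finset_sup'_apply _ fun b _ => G.continuous_actionValue i θ b
    refine hsup.sub (continuous_finsetSum _ fun b _ => ?_)
    have := G.continuous_actionValue i θ b
    fun_prop

lemma nonempty_state (G : BaseGame I Θ A) : Nonempty Θ := by
  by_contra h
  rw [not_nonempty_iff] at h
  have := G.prior_sum
  simp at this

lemma nonempty_action {p : (∀ j, A j) × Θ → ℝ} (hp : p ∈ G.outcomes) (i : I) :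
    Nonempty (A i) := by
  by_contra h
  rw [not_nonempty_iff] at h
  obtain ⟨θ⟩ := G.nonempty_state
  have h1 := hp.2 θ
  have : IsEmpty (∀ j, A j) := ⟨fun a => h.elim (a i)⟩
  rw [Finset.univ_eq_empty, Finset.sum_empty] at h1
  exact absurd h1 (G.prior_pos θ).ne

/-- `q` is the outcome of players mixing independently according to `α z θ` conditional on a
correlation state `z` with distribution `ζ θ` and the payoff state `θ`, in such a way that actions
with the same conditional distribution are conditionally independent of the state, and that each
player's expected loss relative to best responding to the realized states is at most `η`. -/
structure IsDecomposition {Z : Type*} [Fintype Z] (q : (∀ j, A j) × Θ → ℝ) (η : ℝ)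
    (ζ : Θ → stdSimplex ℝ Z) (α : Z → Θ → ∀ j, stdSimplex ℝ (A j)) : Prop where
  outcome : ∀ a θ, q (a, θ) = ∑ z, ζ θ z * G.prior θ * ∏ j, α z θ j (a j)
  proportional : ∀ i, ∀ x ∈ suppAct q i, ∀ x' ∈ suppAct q i, cond q i x = cond q i x' →
    ∀ z θ, 0 < ζ θ z → α z θ i x * actionProb q i x' = α z θ i x' * actionProb q i x
  regret_le : ∀ i, ∑ z, ∑ θ, ζ θ z * G.prior θ * G.regret i (fun j => α z θ j) θ ≤ η

variable {G}

/-- Expected values conditional on player `i`'s action `x` in a mixture of independent mixed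
actions. -/
lemma sum_others_of_mixture {Z : Type*} [Fintype Z] {q : (∀ j, A j) × Θ → ℝ}
    {ζ : Θ → stdSimplex ℝ Z} {α : Z → Θ → ∀ j, stdSimplex ℝ (A j)}
    (hq : ∀ a θ, q (a, θ) = ∑ z, ζ θ z * G.prior θ * ∏ j, α z θ j (a j))
    (i : I) (x : A i) (f : Others A i → Θ → ℝ) :
    ∑ y : Others A i, ∑ θ, f y θ * q (combine i x y, θ) =
      ∑ z, ∑ θ, ζ θ z * G.prior θ * α z θ i x *
        ∑ y : Others A i, f y θ * ∏ j : {j // j ≠ i}, α z θ j (y j) := by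
  simp_rw [hq, Finset.mul_sum]
  rw [Finset.sum_comm]
  simp_rw [Finset.sum_comm (s := (Finset.univ : Finset (Others A i)))]
  rw [Finset.sum_comm]
  refine Finset.sum_congr rfl fun z _ => Finset.sum_congr rfl fun θ _ =>
    Finset.sum_congr rfl fun y _ => ?_
  rw [prod_combine i x y fun j => α z θ j]
  ring

lemma actionProb_of_mixture {Z : Type*} [Fintype Z] {q : (∀ j, A j) × Θ → ℝ}
    {ζ : Θ → stdSimplex ℝ Z} {α : Z → Θ → ∀ j, stdSimplex ℝ (A j)}
    (hq : ∀ a θ, q (a, θ) = ∑ z, ζ θ z * G.prior θ * ∏ j, α z θ j (a j)) (i : I) (x : A i) :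
    actionProb q i x = ∑ z, ∑ θ, ζ θ z * G.prior θ * α z θ i x := by
  have := sum_others_of_mixture hq i x fun _ _ => 1
  simp only [one_mul, sum_prod_others, mul_one] at this
  exact this

lemma sum_value_of_mixture {Z : Type*} [Fintype Z] {q : (∀ j, A j) × Θ → ℝ}
    {ζ : Θ → stdSimplex ℝ Z} {α : Z → Θ → ∀ j, stdSimplex ℝ (A j)}
    (hq : ∀ a θ, q (a, θ) = ∑ z, ζ θ z * G.prior θ * ∏ j, α z θ j (a j)) (i : I) (x b : A i) :
    ∑ y : Others A i, ∑ θ, G.u i (combine i b y) θ * q (combine i x y, θ) =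
      ∑ z, ∑ θ, ζ θ z * G.prior θ * α z θ i x * G.actionValue i (fun j => α z θ j) θ b :=
  sum_others_of_mixture hq i x fun y θ => G.u i (combine i b y) θ

lemma mem_outcomes_of_mixture {Z : Type*} [Fintype Z] {q : (∀ j, A j) × Θ → ℝ}
    {ζ : Θ → stdSimplex ℝ Z} {α : Z → Θ → ∀ j, stdSimplex ℝ (A j)}
    (hq : ∀ a θ, q (a, θ) = ∑ z, ζ θ z * G.prior θ * ∏ j, α z θ j (a j)) : q ∈ G.outcomes := by
  have hm : ∀ θ, ∑ a, q (a, θ) = G.prior θ := by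
    intro θ
    simp_rw [hq]
    rw [Finset.sum_comm]
    simp_rw [← Finset.mul_sum, sum_prod_profile, mul_one, ← Finset.sum_mul, stdSimplex.sum_eq_one,
      one_mul]
  refine ⟨⟨?_, ?_⟩, hm⟩
  · rintro ⟨a, θ⟩
    rw [hq]
    exact Finset.sum_nonneg fun z _ => mul_nonneg
      (mul_nonneg (stdSimplex.zero_le _ _) (G.prior_pos θ).le)
      (Finset.prod_nonneg fun j _ => stdSimplex.zero_le _ _)
  · rw [Fintype.sum_prod_type_right]
    simp_rw [hm, G.prior_sum]

end BaseGame

/-! ### Action probabilities and conditional distributions, without division. -/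

lemma actionProb_nonneg {p : (∀ j, A j) × Θ → ℝ} (hp : ∀ aθ, 0 ≤ p aθ) (i : I) (x : A i) :
    0 ≤ actionProb p i x :=
  Finset.sum_nonneg fun _ _ => Finset.sum_nonneg fun _ _ => hp _

lemma le_actionProb {p : (∀ j, A j) × Θ → ℝ} (hp : ∀ aθ, 0 ≤ p aθ) (i : I) (a : ∀ j, A j)
    (θ : Θ) : p (a, θ) ≤ actionProb p i (a i) := by
  have ha : combine i (a i) (fun j => a j) = a :=
    (Equiv.piSplitAt i A).symm_apply_apply a
  have h1 : p (a, θ) ≤ ∑ θ, p (combine i (a i) (fun j => a j), θ) := by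
    rw [ha]
    exact Finset.single_le_sum (f := fun θ => p (a, θ)) (fun _ _ => hp _) (Finset.mem_univ θ)
  exact h1.trans (Finset.single_le_sum
    (f := fun y : Others A i => ∑ θ, p (combine i (a i) y, θ))
    (fun _ _ => Finset.sum_nonneg fun _ _ => hp _) (Finset.mem_univ _))

lemma eq_zero_of_notMem_suppAct {p : (∀ j, A j) × Θ → ℝ} (hp : ∀ aθ, 0 ≤ p aθ) {i : I}
    {x : A i} (hx : x ∉ suppAct p i) : actionProb p i x = 0 :=
  le_antisymm (not_lt.1 hx) (actionProb_nonneg hp i x)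

lemma cond_eq_cond_iff {p : (∀ j, A j) × Θ → ℝ} {i : I} {x x' : A i} (hx : x ∈ suppAct p i)
    (hx' : x' ∈ suppAct p i) : cond p i x = cond p i x' ↔
      ∀ y θ, p (combine i x y, θ) * actionProb p i x' = p (combine i x' y, θ) * actionProb p i x := by
  have h : 0 < actionProb p i x := hx
  have h' : 0 < actionProb p i x' := hx'
  constructor
  · intro e y θ
    have := congrFun e (y, θ)
    simp only [cond] at this
    rwa [div_eq_div_iff h.ne' h'.ne'] at this
  · intro e
    funext ⟨y, θ⟩
    simp only [cond]
    rw [div_eq_div_iff h.ne' h'.ne']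
    exact e y θ

/-- Best responses to a conditional distribution, in terms of the unnormalized distribution. -/
lemma BaseGame.mem_bestResponses_cond_iff (G : BaseGame I Θ A) {p : (∀ j, A j) × Θ → ℝ} {i : I}
    {x : A i} (hx : x ∈ suppAct p i) (b : A i) :
    b ∈ G.bestResponses i (cond p i x) ↔ ∀ b' : A i,
      ∑ y : Others A i, ∑ θ, G.u i (combine i b' y) θ * p (combine i x y, θ) ≤
        ∑ y : Others A i, ∑ θ, G.u i (combine i b y) θ * p (combine i x y, θ) := by
  have h : 0 < actionProb p i x := hx
  refine forall_congr' fun b' => ?_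
  simp_rw [cond, ← mul_div_assoc, ← Finset.sum_div]
  exact div_le_div_iff_of_pos_right h

/-! ### Kernels between finite sets -/

/-- The law of the output of the kernel `g` when its input has law `μ`. -/
def mix {X Y : Type*} [Fintype X] [Fintype Y] (μ : stdSimplex ℝ X) (g : X → stdSimplex ℝ Y) :
    stdSimplex ℝ Y :=
  ⟨fun y => ∑ x, g x y * μ x,
    fun y => Finset.sum_nonneg fun x _ => mul_nonneg (stdSimplex.zero_le _ _)
      (stdSimplex.zero_le _ _), by
    rw [Finset.sum_comm]
    simp_rw [← Finset.sum_mul, stdSimplex.sum_eq_one, one_mul, stdSimplex.sum_eq_one]⟩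

lemma mix_apply {X Y : Type*} [Fintype X] [Fintype Y] (μ : stdSimplex ℝ X)
    (g : X → stdSimplex ℝ Y) (y : Y) : mix μ g y = ∑ x, g x y * μ x := rfl

lemma mix_mix {X Y W : Type*} [Fintype X] [Fintype Y] [Fintype W] (μ : stdSimplex ℝ X)
    (g : X → stdSimplex ℝ Y) (h : Y → stdSimplex ℝ W) :
    mix (mix μ g) h = mix μ fun x => mix (g x) h := by
  ext w
  simp_rw [mix_apply, Finset.mul_sum, Finset.sum_mul]
  rw [Finset.sum_comm]
  refine Finset.sum_congr rfl fun x _ => Finset.sum_congr rfl fun y _ => by ring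

lemma vertex_mix {X Y : Type*} [Fintype X] [Fintype Y] [DecidableEq X] (x : X)
    (g : X → stdSimplex ℝ Y) : mix (stdSimplex.vertex x) g = g x := by
  ext y
  simp [mix_apply, Pi.single_apply]

lemma mix_vertex {X : Type*} [Fintype X] [DecidableEq X] (μ : stdSimplex ℝ X) :
    mix μ stdSimplex.vertex = μ := by
  ext y
  simp [mix_apply, Pi.single_apply]

lemma sum_mix_mul {X Y : Type*} [Fintype X] [Fintype Y] (μ : stdSimplex ℝ X)
    (g : X → stdSimplex ℝ Y) (f : Y → ℝ) :
    ∑ y, mix μ g y * f y = ∑ x, μ x * ∑ y, g x y * f y := by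
  simp_rw [mix_apply, Finset.sum_mul, Finset.mul_sum]
  rw [Finset.sum_comm]
  refine Finset.sum_congr rfl fun x _ => Finset.sum_congr rfl fun y _ => by ring

/-! ### A strictly monotone measure of informativeness -/

section Informativeness

variable {Ω X Y : Type*} [Fintype Ω] [Fintype X] [Fintype Y] {m : Ω → ℝ}
  {ξ : Ω → stdSimplex ℝ X} {ξ' : Ω → stdSimplex ℝ Y} {g : X → stdSimplex ℝ Y}

/-- The probability of the signal `x`. -/
def signalProb (m : Ω → ℝ) (ξ : Ω → stdSimplex ℝ X) (x : X) : ℝ := ∑ ω, m ω * ξ ω x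

/-- The expected squared norm of the posterior. -/
def informativeness (m : Ω → ℝ) (ξ : Ω → stdSimplex ℝ X) : ℝ :=
  ∑ x, ∑ ω, (m ω * ξ ω x) ^ 2 / signalProb m ξ x

/-- The experiment `ξ'` is the garbling of `ξ` by `g`, at the states of positive weight. -/
def IsGarbling (m : Ω → ℝ) (ξ : Ω → stdSimplex ℝ X) (ξ' : Ω → stdSimplex ℝ Y)
    (g : X → stdSimplex ℝ Y) : Prop :=
  ∀ y ω, 0 < m ω → ξ' ω y = ∑ x, g x y * ξ ω x

lemma signalProb_nonneg (hm : ∀ ω, 0 ≤ m ω) (ξ : Ω → stdSimplex ℝ X) (x : X) :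
    0 ≤ signalProb m ξ x :=
  Finset.sum_nonneg fun ω _ => mul_nonneg (hm ω) (stdSimplex.zero_le _ _)

lemma sum_signalProb (m : Ω → ℝ) (ξ : Ω → stdSimplex ℝ X) :
    ∑ x, signalProb m ξ x = ∑ ω, m ω := by
  simp_rw [signalProb]
  rw [Finset.sum_comm]
  simp_rw [← Finset.mul_sum, stdSimplex.sum_eq_one, mul_one]

lemma le_signalProb (hm : ∀ ω, 0 ≤ m ω) (ξ : Ω → stdSimplex ℝ X) (x : X) (ω : Ω) :
    m ω * ξ ω x ≤ signalProb m ξ x :=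
  Finset.single_le_sum (f := fun ω => m ω * ξ ω x)
    (fun ω _ => mul_nonneg (hm ω) (stdSimplex.zero_le _ _)) (Finset.mem_univ ω)

lemma weight_eq_zero_of_signalProb (hm : ∀ ω, 0 ≤ m ω) {x : X} (hx : signalProb m ξ x = 0)
    (ω : Ω) : m ω * ξ ω x = 0 :=
  le_antisymm (hx ▸ le_signalProb hm ξ x ω) (mul_nonneg (hm ω) (stdSimplex.zero_le _ _))

/-- Multiplying by the weight extends the garbling identity to states of weight zero, where
`IsGarbling` says nothing. -/
lemma IsGarbling.weight_eq (h : IsGarbling m ξ ξ' g) (hm : ∀ ω, 0 ≤ m ω) (y : Y) (ω : Ω) :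
    m ω * ξ' ω y = ∑ x, g x y * (m ω * ξ ω x) := by
  rcases (hm ω).eq_or_lt with h0 | h0
  · simp [← h0]
  · rw [h y ω h0, Finset.mul_sum]
    exact Finset.sum_congr rfl fun x _ => by ring

lemma IsGarbling.signalProb_eq (h : IsGarbling m ξ ξ' g) (hm : ∀ ω, 0 ≤ m ω) (y : Y) :
    signalProb m ξ' y = ∑ x, g x y * signalProb m ξ x := by
  simp_rw [signalProb, h.weight_eq hm, Finset.mul_sum]
  rw [Finset.sum_comm]

lemma IsGarbling.mul_signalProb_le (h : IsGarbling m ξ ξ' g) (hm : ∀ ω, 0 ≤ m ω) (x : X) (y : Y) :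
    g x y * signalProb m ξ x ≤ signalProb m ξ' y := by
  rw [h.signalProb_eq hm]
  exact Finset.single_le_sum (f := fun x => g x y * signalProb m ξ x)
    (fun x _ => mul_nonneg (stdSimplex.zero_le _ _) (signalProb_nonneg hm ξ x))
    (Finset.mem_univ x)

/-- Pythagoras: a posterior of the garbled experiment is the average of the original posteriors sent
to it, so the loss in expected squared norm is the expected squared distance between them. -/
lemma IsGarbling.informativeness_sub (h : IsGarbling m ξ ξ' g) (hm : ∀ ω, 0 ≤ m ω) :
    informativeness m ξ - informativeness m ξ' = ∑ y, ∑ x, ∑ ω, g x y * signalProb m ξ x *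
      (m ω * ξ ω x / signalProb m ξ x - m ω * ξ' ω y / signalProb m ξ' y) ^ 2 := by
  have key : ∀ y x ω, g x y * signalProb m ξ x *
      (m ω * ξ ω x / signalProb m ξ x - m ω * ξ' ω y / signalProb m ξ' y) ^ 2 =
      g x y * ((m ω * ξ ω x) ^ 2 / signalProb m ξ x) -
        2 * (g x y * (m ω * ξ ω x)) * (m ω * ξ' ω y / signalProb m ξ' y) +
        g x y * signalProb m ξ x * (m ω * ξ' ω y / signalProb m ξ' y) ^ 2 := by
    intro y x ω
    rcases eq_or_ne (signalProb m ξ x) 0 with h0 | h0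
    · simp [h0, weight_eq_zero_of_signalProb hm h0 ω]
    · generalize m ω * ξ' ω y / signalProb m ξ' y = r
      field_simp
      ring
  simp_rw [key, Finset.sum_add_distrib, Finset.sum_sub_distrib]
  have h1 : ∑ y, ∑ x, ∑ ω, g x y * ((m ω * ξ ω x) ^ 2 / signalProb m ξ x) =
      informativeness m ξ := by
    rw [Finset.sum_comm]
    refine Finset.sum_congr rfl fun x _ => ?_
    rw [Finset.sum_comm]
    refine Finset.sum_congr rfl fun ω _ => ?_
    rw [← Finset.sum_mul, stdSimplex.sum_eq_one, one_mul]
  have h2 : ∑ y, ∑ x, ∑ ω, 2 * (g x y * (m ω * ξ ω x)) * (m ω * ξ' ω y / signalProb m ξ' y) =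
      2 * informativeness m ξ' := by
    rw [informativeness, Finset.mul_sum]
    refine Finset.sum_congr rfl fun y _ => ?_
    rw [Finset.sum_comm, Finset.mul_sum]
    refine Finset.sum_congr rfl fun ω _ => ?_
    rw [← Finset.sum_mul, ← Finset.mul_sum, ← h.weight_eq hm]
    ring
  have h3 : ∑ y, ∑ x, ∑ ω, g x y * signalProb m ξ x * (m ω * ξ' ω y / signalProb m ξ' y) ^ 2 =
      informativeness m ξ' := by
    refine Finset.sum_congr rfl fun y _ => ?_
    rw [Finset.sum_comm]
    refine Finset.sum_congr rfl fun ω _ => ?_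
    rw [← Finset.sum_mul, ← h.signalProb_eq hm]
    rcases eq_or_ne (signalProb m ξ' y) 0 with h0 | h0
    · simp [h0]
    · field_simp
  rw [h1, h2, h3]
  ring

lemma IsGarbling.informativeness_le (h : IsGarbling m ξ ξ' g) (hm : ∀ ω, 0 ≤ m ω) :
    informativeness m ξ' ≤ informativeness m ξ := by
  rw [← sub_nonneg, h.informativeness_sub hm]
  exact Finset.sum_nonneg fun y _ => Finset.sum_nonneg fun x _ => Finset.sum_nonneg fun ω _ =>
    mul_nonneg (mul_nonneg (stdSimplex.zero_le _ _) (signalProb_nonneg hm ξ x)) (sq_nonneg _)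

/-- If a garbling loses no information, a signal and its garbled versions have the same
posterior. -/
lemma IsGarbling.weight_mul_eq (h : IsGarbling m ξ ξ' g) (hm : ∀ ω, 0 ≤ m ω)
    (heq : informativeness m ξ ≤ informativeness m ξ') {x : X} {y : Y} (hxy : 0 < g x y) (ω : Ω) :
    m ω * ξ ω x * signalProb m ξ' y = m ω * ξ' ω y * signalProb m ξ x := by
  rcases (signalProb_nonneg hm ξ x).eq_or_lt with h0 | h0
  · rw [weight_eq_zero_of_signalProb hm h0.symm, ← h0, zero_mul, mul_zero]
  have hy : 0 < signalProb m ξ' y := (mul_pos hxy h0).trans_le (h.mul_signalProb_le hm x y)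
  have hnn : ∀ y x ω, 0 ≤ g x y * signalProb m ξ x *
      (m ω * ξ ω x / signalProb m ξ x - m ω * ξ' ω y / signalProb m ξ' y) ^ 2 := fun y x ω =>
    mul_nonneg (mul_nonneg (stdSimplex.zero_le _ _) (signalProb_nonneg hm ξ x)) (sq_nonneg _)
  have hs : ∑ y, ∑ x, ∑ ω, g x y * signalProb m ξ x *
      (m ω * ξ ω x / signalProb m ξ x - m ω * ξ' ω y / signalProb m ξ' y) ^ 2 = 0 :=
    le_antisymm (by rw [← h.informativeness_sub hm]; exact sub_nonpos.2 heq)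
      (Finset.sum_nonneg fun y _ => Finset.sum_nonneg fun x _ => Finset.sum_nonneg fun ω _ =>
        hnn y x ω)
  rw [Finset.sum_eq_zero_iff_of_nonneg fun y _ => Finset.sum_nonneg fun x _ =>
    Finset.sum_nonneg fun ω _ => hnn y x ω] at hs
  have hs1 := hs y (Finset.mem_univ y)
  rw [Finset.sum_eq_zero_iff_of_nonneg fun x _ => Finset.sum_nonneg fun ω _ => hnn y x ω] at hs1
  have hs2 := hs1 x (Finset.mem_univ x)
  rw [Finset.sum_eq_zero_iff_of_nonneg fun ω _ => hnn y x ω] at hs2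
  have hs3 := hs2 ω (Finset.mem_univ ω)
  rw [mul_eq_zero, or_iff_right (mul_pos hxy h0).ne', sq_eq_zero_iff, sub_eq_zero,
    div_eq_div_iff h0.ne' hy.ne'] at hs3
  exact hs3

/-- A garbling that loses no information can be reversed. -/
lemma IsGarbling.exists_reverse [Nonempty X] (h : IsGarbling m ξ ξ' g) (hm : ∀ ω, 0 ≤ m ω)
    (heq : informativeness m ξ ≤ informativeness m ξ') :
    ∃ g' : Y → stdSimplex ℝ X, IsGarbling m ξ' ξ g' := by
  classical
  -- Bayes' rule for the original signal given its garbled version; the value at signals of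
  -- probability zero is immaterial.
  let g' : Y → stdSimplex ℝ X := fun y =>
    if hy : 0 < signalProb m ξ' y then
      ⟨fun x => g x y * signalProb m ξ x / signalProb m ξ' y,
        fun x => div_nonneg (mul_nonneg (stdSimplex.zero_le _ _) (signalProb_nonneg hm ξ x)) hy.le,
        by rw [← Finset.sum_div, ← h.signalProb_eq hm, div_self hy.ne']⟩
    else stdSimplex.vertex (Classical.arbitrary X)
  refine ⟨g', fun x ω hω => ?_⟩
  have key : ∀ y, g' y x * (m ω * ξ' ω y) = g x y * (m ω * ξ ω x) := by
    intro y
    by_cases hy : 0 < signalProb m ξ' y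
    · have : g' y x = g x y * signalProb m ξ x / signalProb m ξ' y := by
        simp only [g', dif_pos hy]
        rfl
      rw [this]
      rcases (stdSimplex.zero_le (g x) y).eq_or_lt with hg | hg
      · simp [← hg]
      · have := h.weight_mul_eq hm heq hg ω
        rw [div_mul_eq_mul_div, div_eq_iff hy.ne']
        linear_combination -(g x y) * this
    · have hy0 : signalProb m ξ' y = 0 := le_antisymm (not_lt.1 hy) (signalProb_nonneg hm ξ' y)
      rw [weight_eq_zero_of_signalProb hm hy0, mul_zero]
      rcases (stdSimplex.zero_le (g x) y).eq_or_lt with hg | hg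
      · simp [← hg]
      · have h1 := h.mul_signalProb_le hm x y
        rw [hy0] at h1
        have h2 : signalProb m ξ x = 0 :=
          le_antisymm (nonpos_of_mul_nonpos_right h1 hg) (signalProb_nonneg hm ξ x)
        rw [weight_eq_zero_of_signalProb hm h2, mul_zero]
  have hsum : m ω * ξ ω x = m ω * ∑ y, g' y x * ξ' ω y := by
    rw [Finset.mul_sum]
    calc m ω * ξ ω x = ∑ y, g x y * (m ω * ξ ω x) := by
          rw [← Finset.sum_mul, stdSimplex.sum_eq_one, one_mul]
      _ = ∑ y, g' y x * (m ω * ξ' ω y) := Finset.sum_congr rfl fun y _ => (key y).symm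
      _ = _ := Finset.sum_congr rfl fun y _ => by ring
  exact mul_left_cancel₀ hω.ne' hsum

end Informativeness

/-! ### Payoffs and outcomes of the information acquisition game -/

/-- The probability of the correlation and payoff states. -/
def Technology.stateProb (G : BaseGame I Θ A) (T : Technology Θ A) (zθ : T.Z × Θ) : ℝ :=
  T.ζ zθ.2 zθ.1 * G.prior zθ.2

lemma Technology.stateProb_nonneg (G : BaseGame I Θ A) (T : Technology Θ A) (zθ : T.Z × Θ) :
    0 ≤ T.stateProb G zθ :=
  mul_nonneg (stdSimplex.zero_le _ _) (G.prior_pos _).le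

/-- Since the prior has full support, `ζ θ z` and the joint weight are positive at the same states.
-/
lemma Technology.dominates_iff (G : BaseGame I Θ A) (T : Technology Θ A) (i : I)
    (ξ ξ' : T.Experiment i) :
    T.Dominates i ξ ξ' ↔ ∃ g, IsGarbling (T.stateProb G) ξ ξ' g := by
  refine exists_congr fun g => ⟨fun h x zθ hz => h x zθ.2 zθ.1 ?_, fun h x θ z hz =>
    h x (z, θ) (mul_pos hz (G.prior_pos θ))⟩
  exact (mul_pos_iff_of_pos_right (G.prior_pos zθ.2)).1 hz

lemma sum_prod_mix {X : I → Type*} [∀ i, Fintype (X i)] (μ : ∀ i, stdSimplex ℝ (X i))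
    (σ : ∀ i, X i → stdSimplex ℝ (A i)) (a : ∀ i, A i) :
    ∑ x : ∀ j, X j, ∏ j, σ j (x j) (a j) * μ j (x j) = ∏ j, mix (μ j) (σ j) (a j) := by
  simp_rw [mix_apply]
  rw [Finset.prod_univ_sum, Fintype.piFinset_univ]

lemma outcomeOf_apply (G : BaseGame I Θ A) (T : Technology Θ A) (ξ : ∀ j, T.Experiment j)
    (σ : ∀ j, T.Plan j) (a : ∀ j, A j) (θ : Θ) :
    outcomeOf G T ξ σ (a, θ) =
      ∑ z, T.ζ θ z * G.prior θ * ∏ j, mix (ξ j (z, θ)) (σ j) (a j) := by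
  simp_rw [outcomeOf, ← sum_prod_mix]
  rw [Finset.sum_comm]
  refine Finset.sum_congr rfl fun z _ => ?_
  rw [Finset.mul_sum]
  exact Finset.sum_congr rfl fun x _ => by ring

/-- Signals are independent across players given `(z, θ)`, so apart from the cost a strategy matters
only through the mixed action it induces at each state. -/
lemma payoff_eq (G : BaseGame I Θ A) (T : Technology Θ A) (i : I) (ξi : T.Experiment i)
    (σi : T.Plan i) (ξ : ∀ j, T.Experiment j) (σ : ∀ j, T.Plan j) :
    payoff G T i ξi σi ξ σ = (∑ z, ∑ θ, T.ζ θ z * G.prior θ * ∑ b, mix (ξi (z, θ)) σi b *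
      G.actionValue i (fun j => mix (ξ j (z, θ)) (σ j)) θ b) - T.cost i ξi := by
  rw [payoff]
  congr 1
  have h1 : ∀ (a : ∀ j, A j) (z : T.Z) (θ : Θ),
      ∑ x : ∀ j, T.X j, (σi (x i) (a i) * ξi (z, θ) (x i)) *
        ∏ j ∈ Finset.univ.erase i, σ j (x j) (a j) * ξ j (z, θ) (x j) =
      mix (ξi (z, θ)) σi (a i) * ∏ j ∈ Finset.univ.erase i, mix (ξ j (z, θ)) (σ j) (a j) := by
    intro a z θ
    -- Inserting the deviation as the `i`-th component lets the product formula apply to the whole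
    -- profile.
    have h := sum_prod_mix (fun j => Function.update ξ i ξi j (z, θ)) (Function.update σ i σi) a
    simp_rw [← Finset.mul_prod_erase _ _ (Finset.mem_univ i), Function.update_self] at h
    have hc : ∀ (f : ∀ j, (T.X j → stdSimplex ℝ (A j)) → T.Experiment j → ℝ),
        ∏ j ∈ Finset.univ.erase i, f j (Function.update σ i σi j) (Function.update ξ i ξi j) =
        ∏ j ∈ Finset.univ.erase i, f j (σ j) (ξ j) := fun f =>
      Finset.prod_congr rfl fun j hj => by
        rw [Function.update_of_ne (Finset.ne_of_mem_erase hj),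
          Function.update_of_ne (Finset.ne_of_mem_erase hj)]
    rw [hc fun j s e => mix (e (z, θ)) s (a j)] at h
    rw [← h]
    refine Finset.sum_congr rfl fun x _ => ?_
    rw [hc fun j s e => s (x j) (a j) * e (z, θ) (x j)]
  calc _ = ∑ a : ∀ j, A j, ∑ z, ∑ θ, T.ζ θ z * G.prior θ * (G.u i a θ *
        mix (ξi (z, θ)) σi (a i) * ∏ j ∈ Finset.univ.erase i, mix (ξ j (z, θ)) (σ j) (a j)) := by
        refine Finset.sum_congr rfl fun a _ => ?_
        rw [Finset.sum_comm]
        refine Finset.sum_congr rfl fun z _ => ?_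
        rw [Finset.sum_comm]
        refine Finset.sum_congr rfl fun θ _ => ?_
        rw [mul_assoc (G.u i a θ), ← h1, Finset.mul_sum, Finset.mul_sum]
        exact Finset.sum_congr rfl fun x _ => by ring
    _ = _ := by
        rw [Finset.sum_comm]
        refine Finset.sum_congr rfl fun z _ => ?_
        rw [Finset.sum_comm]
        refine Finset.sum_congr rfl fun θ _ => ?_
        rw [← Finset.mul_sum]
        congr 1
        exact G.sum_payoff_eq_sum_actionValue i (mix (ξi (z, θ)) σi)
          (fun j => mix (ξ j (z, θ)) (σ j)) θ

/-! ### Equilibrium outcomes are separated Bayes correlated equilibria -/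

namespace BaseGame

variable (G : BaseGame I Θ A)

/-- The contribution to player `i`'s expected payoff of playing `b` whenever the outcome `q`
recommends `x`. -/
def recommendationValue (q : (∀ j, A j) × Θ → ℝ) (i : I) (x b : A i) : ℝ :=
  ∑ y : Others A i, ∑ θ, G.u i (combine i b y) θ * q (combine i x y, θ)

lemma isBCE_iff {q : (∀ j, A j) × Θ → ℝ} : G.IsBCE q ↔ q ∈ G.outcomes ∧
    ∀ i, ∀ x b : A i, G.recommendationValue q i x b ≤ G.recommendationValue q i x x := by
  refine and_congr_right fun _ => forall_congr' fun i => forall_congr' fun x =>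
    forall_congr' fun b => ?_
  simp_rw [sub_mul, Finset.sum_sub_distrib, sub_nonneg]
  rfl

variable {G}

/-- By linearity the correlation state drops out: the payoff from garbling one's own recommendation
depends on the outcome `q` alone. -/
lemma sum_mix_actionValue {Z : Type*} [Fintype Z] {q : (∀ j, A j) × Θ → ℝ}
    {ζ : Θ → stdSimplex ℝ Z} {α : Z → Θ → ∀ j, stdSimplex ℝ (A j)}
    (hq : ∀ a θ, q (a, θ) = ∑ z, ζ θ z * G.prior θ * ∏ j, α z θ j (a j)) (i : I)
    (k : A i → stdSimplex ℝ (A i)) :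
    ∑ z, ∑ θ, ζ θ z * G.prior θ * ∑ b, mix (α z θ i) k b *
      G.actionValue i (fun j => α z θ j) θ b =
    ∑ x, ∑ b, k x b * G.recommendationValue q i x b := by
  simp_rw [recommendationValue, sum_value_of_mixture hq, sum_mix_mul, Finset.mul_sum]
  symm
  calc _ = ∑ x, ∑ z, ∑ θ, ∑ b, k x b * (ζ θ z * G.prior θ * α z θ i x *
        G.actionValue i (fun j => α z θ j) θ b) := by
        refine Finset.sum_congr rfl fun x _ => ?_
        rw [Finset.sum_comm]
        exact Finset.sum_congr rfl fun z _ => Finset.sum_comm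
    _ = ∑ z, ∑ x, ∑ θ, ∑ b, k x b * (ζ θ z * G.prior θ * α z θ i x *
        G.actionValue i (fun j => α z θ j) θ b) := Finset.sum_comm
    _ = _ := by
        refine Finset.sum_congr rfl fun z _ => ?_
        rw [Finset.sum_comm]
        refine Finset.sum_congr rfl fun θ _ => Finset.sum_congr rfl fun x _ =>
          Finset.sum_congr rfl fun b _ => by ring

lemma sum_actionValue_self {Z : Type*} [Fintype Z] {q : (∀ j, A j) × Θ → ℝ}
    {ζ : Θ → stdSimplex ℝ Z} {α : Z → Θ → ∀ j, stdSimplex ℝ (A j)}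
    (hq : ∀ a θ, q (a, θ) = ∑ z, ζ θ z * G.prior θ * ∏ j, α z θ j (a j)) (i : I) :
    ∑ z, ∑ θ, ζ θ z * G.prior θ * ∑ b, α z θ i b *
      G.actionValue i (fun j => α z θ j) θ b = ∑ x, G.recommendationValue q i x x := by
  classical
  have := sum_mix_actionValue hq i stdSimplex.vertex
  simpa [mix_vertex, Pi.single_apply] using this

end BaseGame

section Equilibrium

variable {G : BaseGame I Θ A} {T : Technology Θ A} {ξ : ∀ j, T.Experiment j}
  {σ : ∀ j, T.Plan j}

lemma signalProb_stateProb_mix (i : I) (x : A i) :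
    signalProb (T.stateProb G) (fun zθ => mix (ξ i zθ) (σ i)) x =
      actionProb (outcomeOf G T ξ σ) i x := by
  rw [BaseGame.actionProb_of_mixture (α := fun z θ j => mix (ξ j (z, θ)) (σ j))
    (outcomeOf_apply G T ξ σ), signalProb, Fintype.sum_prod_type]
  rfl

/-- The payoff from garbling one's own equilibrium action. -/
lemma payoff_mix_mix (i : I) (k : A i → stdSimplex ℝ (A i)) (ξi : T.Experiment i) (σi : T.Plan i)
    (h : ∀ zθ, mix (ξi zθ) σi = mix (mix (ξ i zθ) (σ i)) k) :
    payoff G T i ξi σi ξ σ =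
      (∑ x, ∑ b, k x b * G.recommendationValue (outcomeOf G T ξ σ) i x b) - T.cost i ξi := by
  rw [payoff_eq, ← BaseGame.sum_mix_actionValue (α := fun z θ j => mix (ξ j (z, θ)) (σ j))
    (outcomeOf_apply G T ξ σ)]
  simp_rw [h]

lemma payoff_self (i : I) : payoff G T i (ξ i) (σ i) ξ σ =
    (∑ x, G.recommendationValue (outcomeOf G T ξ σ) i x x) - T.cost i (ξ i) := by
  classical
  rw [payoff_mix_mix i stdSimplex.vertex _ _ fun zθ => (mix_vertex _).symm]
  simp [Pi.single_apply]

lemma IsEquilibrium.isBCE (h : IsEquilibrium G T ξ σ) : G.IsBCE (outcomeOf G T ξ σ) := by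
  classical
  refine (G.isBCE_iff).2 ⟨BaseGame.mem_outcomes_of_mixture
    (α := fun z θ j => mix (ξ j (z, θ)) (σ j)) (outcomeOf_apply G T ξ σ), fun i x b => ?_⟩
  -- The deviation keeps the experiment, so its cost cancels, and plays `b` whenever the plan would
  -- have played `x`.
  have h1 := (h i).2 (ξ i) (h i).1 fun s => mix (σ i s) fun y =>
    stdSimplex.vertex (Function.update id x b y)
  rw [payoff_mix_mix i (fun y => stdSimplex.vertex (Function.update id x b y)) _ _
    fun zθ => (mix_mix _ _ _).symm, payoff_self, sub_le_sub_iff_right] at h1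
  simp only [stdSimplex.vertex_coe, Pi.single_apply, ite_mul, one_mul, zero_mul,
    Finset.sum_ite_eq', Finset.mem_univ, if_true] at h1
  rw [← Finset.add_sum_erase _ _ (Finset.mem_univ x),
    ← Finset.add_sum_erase _ (fun x => G.recommendationValue (outcomeOf G T ξ σ) i x x)
      (Finset.mem_univ x), Function.update_self] at h1
  have h2 : ∑ y ∈ Finset.univ.erase x, G.recommendationValue (outcomeOf G T ξ σ) i y
      (Function.update id x b y) = ∑ y ∈ Finset.univ.erase x,
        G.recommendationValue (outcomeOf G T ξ σ) i y y :=
    Finset.sum_congr rfl fun y hy => by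
      rw [Function.update_of_ne (Finset.ne_of_mem_erase hy), id]
  rw [h2] at h1
  exact (add_le_add_iff_right _).1 h1

/-- If two recommendations have a common best response, acquiring information that distinguishes
them is wasteful; hence they are conditionally independent of the state. -/
lemma IsEquilibrium.proportional (h : IsEquilibrium G T ξ σ) (hT : T.IsUnconstrainedRI) (i : I)
    {x x' : A i} (hx : x ∈ suppAct (outcomeOf G T ξ σ) i)
    (hx' : x' ∈ suppAct (outcomeOf G T ξ σ) i) {b : A i}
    (hb : b ∈ G.bestResponses i (cond (outcomeOf G T ξ σ) i x))
    (hb' : b ∈ G.bestResponses i (cond (outcomeOf G T ξ σ) i x')) (zθ : T.Z × Θ) :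
    T.stateProb G zθ * mix (ξ i zθ) (σ i) x * actionProb (outcomeOf G T ξ σ) i x' =
      T.stateProb G zθ * mix (ξ i zθ) (σ i) x' * actionProb (outcomeOf G T ξ σ) i x := by
  classical
  rcases eq_or_ne x' x with rfl | hne
  · rfl
  have hm := T.stateProb_nonneg G
  obtain ⟨e⟩ : Nonempty (A i ↪ T.X i) :=
    Function.Embedding.nonempty_of_card_le (T.card_action_lt i).le
  have hXne : Nonempty (T.X i) := ⟨e x⟩
  have hAne : Nonempty (A i) := ⟨x⟩
  have hr : ∀ y, Function.invFun e (e y) = y := Function.leftInverse_invFun e.injective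
  -- `f` merges `x'` into `x` and `ρ` answers the merged recommendation with the common best
  -- response `b`; the embedding `e` transmits recommendations as signals.
  set f : A i → A i := Function.update id x' x with hf
  set ρ : A i → A i := Function.update id x b with hρ
  have hfx : f x = x := by rw [hf, Function.update_of_ne hne.symm, id]
  have hfx' : f x' = x := by rw [hf, Function.update_self]
  set g : A i → stdSimplex ℝ (T.X i) := fun y => stdSimplex.vertex (e (f y)) with hg
  set ξf : T.Experiment i := fun zθ => mix (mix (ξ i zθ) (σ i)) g with hξf
  set β : T.Z × Θ → stdSimplex ℝ (A i) := fun zθ => mix (ξ i zθ) (σ i) with hβ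
  have hpay := (h i).2 ξf (by rw [(hT i).1]; trivial)
    fun s => stdSimplex.vertex (ρ (Function.invFun e s))
  rw [payoff_mix_mix i (fun y => stdSimplex.vertex (ρ (f y))) _ _ (fun zθ => by
    rw [hξf, mix_mix]
    congr 1
    funext y
    rw [hg, vertex_mix, hr]), payoff_self] at hpay
  have hbce := ((G.isBCE_iff).1 h.isBCE).2
  have hval : ∀ y, G.recommendationValue (outcomeOf G T ξ σ) i y (ρ (f y)) =
      G.recommendationValue (outcomeOf G T ξ σ) i y y := by
    intro y
    by_cases hy : y = x
    · subst hy
      rw [hfx, hρ, Function.update_self]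
      exact le_antisymm (hbce i y b) ((G.mem_bestResponses_cond_iff hx b).1 hb y)
    by_cases hy' : y = x'
    · subst hy'
      rw [hfx', hρ, Function.update_self]
      exact le_antisymm (hbce i y b) ((G.mem_bestResponses_cond_iff hx' b).1 hb' y)
    · rw [hf, Function.update_of_ne hy', id, hρ, Function.update_of_ne hy, id]
  simp only [stdSimplex.vertex_coe, Pi.single_apply, ite_mul, one_mul, zero_mul,
    Finset.sum_ite_eq', Finset.mem_univ, if_true, hval,
    sub_le_sub_iff_left] at hpay
  have hdom : T.Dominates i (ξ i) ξf :=
    (T.dominates_iff G i _ _).2 ⟨fun s => mix (σ i s) g, fun s zθ _ => by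
      change mix (mix (ξ i zθ) (σ i)) g s = _
      rw [mix_mix]
      rfl⟩
  -- The deviation to `ξf` earns the same gross payoff, so it cannot be strictly cheaper.
  have hdom' : T.Dominates i ξf (ξ i) := by
    by_contra hnot
    have := ((hT i).2 (ξ i) (by rw [(hT i).1]; trivial) ξf (by rw [(hT i).1]; trivial) hdom).2 hnot
    exact absurd hpay (not_le.2 this)
  obtain ⟨g', hg'⟩ := (T.dominates_iff G i _ _).1 hdom'
  have hgar : IsGarbling (T.stateProb G) β ξf g := fun s zθ _ => rfl
  have hgar' : IsGarbling (T.stateProb G) (ξ i) β (σ i) := fun s zθ _ => rfl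
  -- `β` is a garbling of `ξ i`, which is a garbling of `ξf`, which is a garbling of `β`: no
  -- information is lost around this loop. Hence `x` and `x'`, both sent to `e x`, have its
  -- posterior.
  have hinf : informativeness (T.stateProb G) β ≤ informativeness (T.stateProb G) ξf :=
    (hgar'.informativeness_le hm).trans (hg'.informativeness_le hm)
  have hpos : 0 < signalProb (T.stateProb G) ξf (e x) := by
    refine lt_of_lt_of_le ?_ (hgar.mul_signalProb_le hm x (e x))
    rw [signalProb_stateProb_mix, hg]
    simp only [hfx, stdSimplex.vertex_coe, Pi.single_eq_same, one_mul]
    exact hx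
  have e1 := hgar.weight_mul_eq hm hinf (x := x) (y := e x) (by simp [hg, hfx]) zθ
  have e2 := hgar.weight_mul_eq hm hinf (x := x') (y := e x) (by simp [hg, hfx']) zθ
  rw [signalProb_stateProb_mix] at e1 e2
  refine mul_right_cancel₀ hpos.ne' ?_
  calc _ = (T.stateProb G zθ * β zθ x * signalProb (T.stateProb G) ξf (e x)) *
        actionProb (outcomeOf G T ξ σ) i x' := by rw [hβ]; ring
    _ = (T.stateProb G zθ * β zθ x' * signalProb (T.stateProb G) ξf (e x)) *
        actionProb (outcomeOf G T ξ σ) i x := by rw [e1, e2]; ring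
    _ = _ := by rw [hβ]; ring

/-- Actions that are proportional conditional on the state have the same conditional
distribution under the outcome. -/
lemma cond_eq_of_proportional {i : I} {x x' : A i} (hx : x ∈ suppAct (outcomeOf G T ξ σ) i)
    (hx' : x' ∈ suppAct (outcomeOf G T ξ σ) i)
    (h : ∀ zθ, T.stateProb G zθ * mix (ξ i zθ) (σ i) x * actionProb (outcomeOf G T ξ σ) i x' =
      T.stateProb G zθ * mix (ξ i zθ) (σ i) x' * actionProb (outcomeOf G T ξ σ) i x) :
    cond (outcomeOf G T ξ σ) i x = cond (outcomeOf G T ξ σ) i x' := by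
  rw [cond_eq_cond_iff hx hx']
  intro y θ
  simp_rw [outcomeOf_apply, Finset.sum_mul]
  refine Finset.sum_congr rfl fun z _ => ?_
  rw [prod_combine i x y fun j => mix (ξ j (z, θ)) (σ j),
    prod_combine i x' y fun j => mix (ξ j (z, θ)) (σ j)]
  have := h (z, θ)
  simp only [Technology.stateProb] at this
  linear_combination (∏ j : {j // j ≠ i}, mix (ξ j (z, θ)) (σ j) (y j)) * this

lemma IsEquilibrium.isSeparatedBCE (h : IsEquilibrium G T ξ σ) (hT : T.IsUnconstrainedRI) :
    G.IsSeparatedBCE (outcomeOf G T ξ σ) := by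
  refine ⟨h.isBCE, fun i x hx x' hx' hne => ?_⟩
  by_contra hcon
  obtain ⟨b, hb, hb'⟩ := Set.nonempty_iff_ne_empty.2 hcon
  exact hne (cond_eq_of_proportional hx hx' (h.proportional hT i hx hx' hb hb'))

/-- An obedient action is a best response to its own conditional, so equal conditionals have a
common best response and `proportional` applies. The regret bound compares with learning `(z, θ)`
fully, at a cost of at most `ε`. -/
lemma IsEquilibrium.isDecomposition (h : IsEquilibrium G T ξ σ) (hT : T.IsUnconstrainedRI) {ε : ℝ}
    (hε : ∀ i, ∀ ξi ∈ T.feasible i, T.cost i ξi ≤ ε) :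
    G.IsDecomposition (outcomeOf G T ξ σ) ε T.ζ fun z θ j => mix (ξ j (z, θ)) (σ j) := by
  classical
  have hq := outcomeOf_apply G T ξ σ
  have hbce := (G.isBCE_iff).1 h.isBCE
  refine ⟨hq, fun i x hx x' hx' hc z θ hz => ?_, fun i => ?_⟩
  · have hb : x ∈ G.bestResponses i (cond (outcomeOf G T ξ σ) i x) :=
      (G.mem_bestResponses_cond_iff hx x).2 (hbce.2 i x)
    have := h.proportional hT i hx hx' hb (hc ▸ hb) (z, θ)
    have hpos : 0 < T.stateProb G (z, θ) := mul_pos hz (G.prior_pos θ)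
    rw [mul_assoc, mul_assoc] at this
    exact mul_left_cancel₀ hpos.ne' this
  · have hA := G.nonempty_action hbce.1 i
    choose br hbr using fun z θ =>
      G.exists_actionValue_eq_iSup i (fun j => mix (ξ j (z, θ)) (σ j)) θ
    -- There are enough signals for a fully revealing experiment; `σi` decodes it and plays a best
    -- reply to the realized state.
    obtain ⟨e⟩ : Nonempty (T.Z × Θ ↪ T.X i) :=
      Function.Embedding.nonempty_of_card_le (T.card_state_lt i).le
    let σi : T.Plan i := fun s => stdSimplex.vertex
      (if hs : ∃ zθ, e zθ = s then br hs.choose.1 hs.choose.2 else Classical.arbitrary _)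
    have hσi : ∀ z θ, σi (e (z, θ)) = stdSimplex.vertex (br z θ) := by
      intro z θ
      have hs : ∃ zθ, e zθ = e (z, θ) := ⟨_, rfl⟩
      simp only [σi, dif_pos hs]
      rw [show hs.choose = (z, θ) from e.injective hs.choose_spec]
    have hfeas : (fun zθ => stdSimplex.vertex (e zθ) : T.Experiment i) ∈ T.feasible i := by
      rw [(hT i).1]
      trivial
    have hpay := (h i).2 _ hfeas σi
    have hc := hε i _ hfeas
    have hc0 := T.cost_nonneg i (ξ i) (h i).1
    rw [payoff_self, payoff_eq,
      ← BaseGame.sum_actionValue_self (α := fun z θ j => mix (ξ j (z, θ)) (σ j)) hq i] at hpay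
    simp_rw [vertex_mix, hσi] at hpay
    simp only [stdSimplex.vertex_coe, Pi.single_apply, ite_mul, one_mul, zero_mul,
      Finset.sum_ite_eq', Finset.mem_univ, if_true, hbr] at hpay
    simp_rw [BaseGame.regret, mul_sub, Finset.sum_sub_distrib]
    linarith

end Equilibrium

/-! ### Supporting an information structure by a monotone cost function -/

section SingleAgent

variable {Ω B X Y : Type*} [Fintype Ω] [Fintype B] [Fintype X] [Fintype Y] {m : Ω → ℝ}

/-- The action `b` is optimal after the recommendation `a`. -/
def IsBestAfter (m : Ω → ℝ) (U : B → Ω → ℝ) (β : Ω → stdSimplex ℝ B) (a b : B) : Prop :=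
  ∀ b', ∑ ω, m ω * β ω a * U b' ω ≤ ∑ ω, m ω * β ω a * U b ω

/-- The functions `c b` are the tangents that turn the squared norm of a posterior into its squared
distance to `ν`, a posterior at which `b` is optimal. By `hsep` all recommendations after which `b`
is optimal share this posterior. -/
lemma exists_penalty (hm : ∀ ω, 0 ≤ m ω) (U : B → Ω → ℝ) (β : Ω → stdSimplex ℝ B)
    (hsep : ∀ a a' b, 0 < signalProb m β a → 0 < signalProb m β a' → IsBestAfter m U β a b →
      IsBestAfter m U β a' b → ∀ ω, m ω * β ω a * signalProb m β a' =
        m ω * β ω a' * signalProb m β a) :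
    ∃ c : B → Ω → ℝ, (∀ b ω, c b ω ≤ 1) ∧
      (∀ w : Ω → ℝ, (∀ ω, 0 ≤ w ω) → ∀ b, 0 ≤ ∑ ω, w ω ^ 2 / ∑ ω, w ω + ∑ ω, w ω * c b ω) ∧
      ∀ a b, 0 < signalProb m β a → IsBestAfter m U β a b →
        ∑ ω, (m ω * β ω a) ^ 2 / signalProb m β a + ∑ ω, m ω * β ω a * c b ω = 0 := by
  classical
  let μ : B → Ω → ℝ := fun a ω => m ω * β ω a / signalProb m β a
  have hμ0 : ∀ a ω, 0 ≤ μ a ω := fun a ω =>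
    div_nonneg (mul_nonneg (hm ω) (stdSimplex.zero_le _ _)) (signalProb_nonneg hm β a)
  have hμ1 : ∀ a ω, μ a ω ≤ 1 := fun a ω =>
    div_le_one_of_le₀ (le_signalProb hm β a ω) (signalProb_nonneg hm β a)
  -- The identity behind the formula is `|μ|² + ∑ μ ω * (|ν|² - 2 * ν ω) = |μ - ν|²` for a
  -- probability vector `μ`. Actions that are optimal after no recommendation of positive
  -- probability need no tangent.
  let c : B → Ω → ℝ := fun b ω =>
    if h : ∃ a, 0 < signalProb m β a ∧ IsBestAfter m U β a b then
      ∑ ω', μ h.choose ω' ^ 2 - 2 * μ h.choose ω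
    else 0
  refine ⟨c, fun b ω => ?_, fun w hw b => ?_, fun a b ha hab => ?_⟩
  · by_cases h : ∃ a, 0 < signalProb m β a ∧ IsBestAfter m U β a b
    · simp only [c, dif_pos h]
      have hsum : ∑ ω', μ h.choose ω' = 1 := by
        simp only [μ]
        rw [← Finset.sum_div]
        exact div_self h.choose_spec.1.ne'
      have : ∑ ω', μ h.choose ω' ^ 2 ≤ ∑ ω', μ h.choose ω' :=
        Finset.sum_le_sum fun ω' _ => by nlinarith [hμ0 h.choose ω', hμ1 h.choose ω']
      linarith [hμ0 h.choose ω]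
    · simp [c, dif_neg h]
  · have hs : 0 ≤ ∑ ω, w ω := Finset.sum_nonneg fun ω _ => hw ω
    by_cases h : ∃ a, 0 < signalProb m β a ∧ IsBestAfter m U β a b
    · simp only [c, dif_pos h]
      generalize μ h.choose = ν
      rcases hs.eq_or_lt with h0 | h0
      · have : ∀ ω, w ω = 0 := fun ω =>
          (Finset.sum_eq_zero_iff_of_nonneg fun ω _ => hw ω).1 h0.symm ω (Finset.mem_univ ω)
        simp [this]
      · have : ∑ ω, w ω ^ 2 / ∑ ω, w ω + ∑ ω, w ω * (∑ ω', ν ω' ^ 2 - 2 * ν ω) =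
            (∑ ω, w ω) * ∑ ω, (w ω / ∑ ω, w ω - ν ω) ^ 2 := by
          simp_rw [mul_sub, Finset.sum_sub_distrib]
          rw [← Finset.sum_mul, Finset.mul_sum, Finset.mul_sum, ← add_sub_assoc,
            ← Finset.sum_add_distrib, ← Finset.sum_sub_distrib]
          refine Finset.sum_congr rfl fun ω _ => ?_
          field_simp
          ring
        rw [this]
        exact mul_nonneg hs (Finset.sum_nonneg fun ω _ => sq_nonneg _)
    · simp only [c, dif_neg h, mul_zero, Finset.sum_const_zero, add_zero]
      exact Finset.sum_nonneg fun ω _ => div_nonneg (sq_nonneg _) hs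
  · have h : ∃ a, 0 < signalProb m β a ∧ IsBestAfter m U β a b := ⟨a, ha, hab⟩
    have hμ : ∀ ω, μ h.choose ω = m ω * β ω a / signalProb m β a := fun ω => by
      simp only [μ]
      rw [div_eq_div_iff h.choose_spec.1.ne' ha.ne']
      exact hsep _ _ b h.choose_spec.1 ha h.choose_spec.2 hab ω
    simp only [c, dif_pos h, hμ, mul_sub, Finset.sum_sub_distrib]
    rw [← Finset.sum_mul]
    change _ + (signalProb m β a * _ - _) = 0
    rw [Finset.mul_sum, ← Finset.sum_sub_distrib, ← Finset.sum_add_distrib]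
    refine Finset.sum_eq_zero fun ω _ => ?_
    field_simp
    ring

/-- A posterior-separable functional that dominates the value of information. -/
def separableCost (m : Ω → ℝ) (U c : B → Ω → ℝ) (κ : ℝ) (ξ : Ω → stdSimplex ℝ X) : ℝ :=
  κ * informativeness m ξ + ∑ x, ⨆ b, ∑ ω, m ω * ξ ω x * (U b ω + κ * c b ω)

/-- A maximum of linear functions is convex, so garbling lowers its expectation. The informativeness
gap is kept explicit because it supplies strictness. -/
lemma IsGarbling.separableCost_le [Nonempty B] {ξ : Ω → stdSimplex ℝ X}
    {ξ' : Ω → stdSimplex ℝ Y} {g : X → stdSimplex ℝ Y} (h : IsGarbling m ξ ξ' g)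
    (hm : ∀ ω, 0 ≤ m ω) (U c : B → Ω → ℝ) (κ : ℝ) :
    separableCost m U c κ ξ' + κ * (informativeness m ξ - informativeness m ξ') ≤
      separableCost m U c κ ξ := by
  have key : ∑ y, ⨆ b, ∑ ω, m ω * ξ' ω y * (U b ω + κ * c b ω) ≤
      ∑ x, ⨆ b, ∑ ω, m ω * ξ ω x * (U b ω + κ * c b ω) := by
    calc _ ≤ ∑ y, ∑ x, g x y * ⨆ b, ∑ ω, m ω * ξ ω x * (U b ω + κ * c b ω) := by
          refine Finset.sum_le_sum fun y _ => ciSup_le fun b => ?_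
          simp_rw [h.weight_eq hm, Finset.sum_mul]
          rw [Finset.sum_comm]
          refine Finset.sum_le_sum fun x _ => ?_
          simp_rw [mul_assoc (g x y)]
          rw [← Finset.mul_sum]
          exact mul_le_mul_of_nonneg_left (le_ciSup (f := fun b =>
            ∑ ω, m ω * ξ ω x * (U b ω + κ * c b ω)) (Set.finite_range _).bddAbove b)
            (stdSimplex.zero_le _ _)
      _ = _ := by
          rw [Finset.sum_comm]
          simp_rw [← Finset.sum_mul, stdSimplex.sum_eq_one, one_mul]
  unfold separableCost
  linarith

/-- After each signal, the quadratic term plus the penalty of any action is nonnegative, so the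
summand of the cost exceeds that action's value. -/
lemma value_le_separableCost (hm : ∀ ω, 0 ≤ m ω) (U c : B → Ω → ℝ) {κ : ℝ} (hκ : 0 ≤ κ)
    (hc : ∀ w : Ω → ℝ, (∀ ω, 0 ≤ w ω) → ∀ b, 0 ≤ ∑ ω, w ω ^ 2 / ∑ ω, w ω + ∑ ω, w ω * c b ω)
    (ξ : Ω → stdSimplex ℝ X) (σ : X → stdSimplex ℝ B) :
    ∑ ω, m ω * ∑ b, mix (ξ ω) σ b * U b ω ≤ separableCost m U c κ ξ := by
  have h1 : ∑ ω, m ω * ∑ b, mix (ξ ω) σ b * U b ω =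
      ∑ x, ∑ b, σ x b * ∑ ω, m ω * ξ ω x * U b ω := by
    simp_rw [sum_mix_mul, Finset.mul_sum]
    rw [Finset.sum_comm]
    refine Finset.sum_congr rfl fun x _ => ?_
    rw [Finset.sum_comm]
    refine Finset.sum_congr rfl fun b _ => Finset.sum_congr rfl fun ω _ => by ring
  rw [h1, separableCost, informativeness, Finset.mul_sum, ← Finset.sum_add_distrib]
  refine Finset.sum_le_sum fun x _ => ?_
  set t := κ * ∑ ω, (m ω * ξ ω x) ^ 2 / signalProb m ξ x +
    ⨆ b, ∑ ω, m ω * ξ ω x * (U b ω + κ * c b ω) with ht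
  have h2 : ∀ b, ∑ ω, m ω * ξ ω x * U b ω ≤ t := by
    intro b
    have h3 := le_ciSup (f := fun b => ∑ ω, m ω * ξ ω x * (U b ω + κ * c b ω))
      (Set.finite_range _).bddAbove b
    have h4 := mul_nonneg hκ (hc (fun ω => m ω * ξ ω x)
      (fun ω => mul_nonneg (hm ω) (stdSimplex.zero_le _ _)) b)
    have h5 : ∑ ω, m ω * ξ ω x * (U b ω + κ * c b ω) =
        ∑ ω, m ω * ξ ω x * U b ω + κ * ∑ ω, m ω * ξ ω x * c b ω := by
      rw [Finset.mul_sum, ← Finset.sum_add_distrib]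
      exact Finset.sum_congr rfl fun ω _ => by ring
    simp only [h5] at h3
    rw [ht]
    simp only [signalProb]
    rw [mul_add] at h4
    linarith
  calc _ ≤ ∑ b, σ x b * t := Finset.sum_le_sum fun b _ =>
        mul_le_mul_of_nonneg_left (h2 b) (stdSimplex.zero_le _ _)
    _ = t := by rw [← Finset.sum_mul, stdSimplex.sum_eq_one, one_mul]

lemma informativeness_le_one (hm : ∀ ω, 0 ≤ m ω) (hm1 : ∑ ω, m ω = 1) (ξ : Ω → stdSimplex ℝ X) :
    informativeness m ξ ≤ 1 := by
  rw [← hm1, ← sum_signalProb m ξ]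
  refine Finset.sum_le_sum fun x _ => Finset.sum_le_sum fun ω _ => ?_
  have h0 : 0 ≤ m ω * ξ ω x := mul_nonneg (hm ω) (stdSimplex.zero_le _ _)
  rw [sq, mul_div_assoc]
  exact mul_le_of_le_one_right h0
    (div_le_one_of_le₀ (le_signalProb hm ξ x ω) (signalProb_nonneg hm ξ x))

/-- The bound is the value of full information, plus `κ` for the penalty and `κ` for the
informativeness. -/
lemma separableCost_le [Nonempty B] (hm : ∀ ω, 0 ≤ m ω) (hm1 : ∑ ω, m ω = 1)
    (U c : B → Ω → ℝ) {κ : ℝ} (hκ : 0 ≤ κ) (hc : ∀ b ω, c b ω ≤ 1) (ξ : Ω → stdSimplex ℝ X) :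
    separableCost m U c κ ξ ≤ ∑ ω, m ω * (⨆ b, U b ω) + 2 * κ := by
  have h1 : ∑ x, ⨆ b, ∑ ω, m ω * ξ ω x * (U b ω + κ * c b ω) ≤
      ∑ x, ∑ ω, m ω * ξ ω x * ((⨆ b, U b ω) + κ) := by
    refine Finset.sum_le_sum fun x _ => ciSup_le fun b => Finset.sum_le_sum fun ω _ => ?_
    refine mul_le_mul_of_nonneg_left (add_le_add ?_ ?_)
      (mul_nonneg (hm ω) (stdSimplex.zero_le _ _))
    · exact le_ciSup (f := fun b => U b ω) (Set.finite_range _).bddAbove b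
    · exact mul_le_of_le_one_right hκ (hc b ω)
  have h2 : ∑ x, ∑ ω, m ω * ξ ω x * ((⨆ b, U b ω) + κ) = ∑ ω, m ω * (⨆ b, U b ω) + κ := by
    rw [Finset.sum_comm]
    simp_rw [← Finset.sum_mul, ← Finset.mul_sum, stdSimplex.sum_eq_one, mul_one, mul_add,
      Finset.sum_add_distrib, ← Finset.sum_mul, hm1, one_mul]
  have h3 := mul_le_of_le_one_right hκ (informativeness_le_one hm hm1 ξ)
  rw [separableCost]
  linarith

/-- For actions optimal after `a` the perturbation vanishes exactly. Every other action is worse by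
a fixed margin, which absorbs a perturbation of order `κ`; there are finitely many pairs. -/
lemma eventually_separableCost_le [Nonempty B] (hm : ∀ ω, 0 ≤ m ω) (U c : B → Ω → ℝ)
    (β : Ω → stdSimplex ℝ B) (hobed : ∀ a, IsBestAfter m U β a a)
    (hc : ∀ a b, 0 < signalProb m β a → IsBestAfter m U β a b →
      ∑ ω, (m ω * β ω a) ^ 2 / signalProb m β a + ∑ ω, m ω * β ω a * c b ω = 0) :
    ∀ᶠ κ in 𝓝[>] (0 : ℝ), separableCost m U c κ β ≤ ∑ ω, m ω * ∑ b, β ω b * U b ω := by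
  have key : ∀ a b, ∀ᶠ κ in 𝓝[>] (0 : ℝ), κ * ∑ ω, (m ω * β ω a) ^ 2 / signalProb m β a +
      ∑ ω, m ω * β ω a * (U b ω + κ * c b ω) ≤ ∑ ω, m ω * β ω a * U a ω := by
    intro a b
    have hsplit : ∀ κ : ℝ, κ * ∑ ω, (m ω * β ω a) ^ 2 / signalProb m β a +
        ∑ ω, m ω * β ω a * (U b ω + κ * c b ω) = κ * (∑ ω, (m ω * β ω a) ^ 2 / signalProb m β a +
          ∑ ω, m ω * β ω a * c b ω) + ∑ ω, m ω * β ω a * U b ω := by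
      intro κ
      rw [mul_add, add_assoc, Finset.mul_sum (s := Finset.univ) (f := fun ω => m ω * β ω a * c b ω),
        ← Finset.sum_add_distrib]
      congr 1
      exact Finset.sum_congr rfl fun ω _ => by ring
    simp_rw [hsplit]
    rcases (signalProb_nonneg hm β a).eq_or_lt with h0 | h0
    · have := weight_eq_zero_of_signalProb hm h0.symm
      simp [this]
    by_cases hb : IsBestAfter m U β a b
    · simp_rw [hc a b h0 hb, mul_zero, zero_add]
      exact Filter.Eventually.of_forall fun _ => hobed a b
    · have hlt : ∑ ω, m ω * β ω a * U b ω < ∑ ω, m ω * β ω a * U a ω := by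
        simp only [IsBestAfter, not_forall, not_le] at hb
        obtain ⟨b', hb'⟩ := hb
        exact hb'.trans_le (hobed a b')
      have ht : Filter.Tendsto (fun κ : ℝ => κ * (∑ ω, (m ω * β ω a) ^ 2 / signalProb m β a +
          ∑ ω, m ω * β ω a * c b ω) + ∑ ω, m ω * β ω a * U b ω) (𝓝[>] 0)
          (𝓝 (∑ ω, m ω * β ω a * U b ω)) := by
        refine Filter.Tendsto.mono_left ?_ nhdsWithin_le_nhds
        have hcont : Continuous fun κ : ℝ => κ * (∑ ω, (m ω * β ω a) ^ 2 / signalProb m β a +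
          ∑ ω, m ω * β ω a * c b ω) + ∑ ω, m ω * β ω a * U b ω := by fun_prop
        simpa using hcont.tendsto 0
      exact (ht.eventually_lt_const hlt).mono fun _ h => h.le
  have hall : ∀ᶠ κ in 𝓝[>] (0 : ℝ), ∀ a b, κ * ∑ ω, (m ω * β ω a) ^ 2 / signalProb m β a +
      ∑ ω, m ω * β ω a * (U b ω + κ * c b ω) ≤ ∑ ω, m ω * β ω a * U a ω := by
    simp_rw [Filter.eventually_all]
    exact key
  refine hall.mono fun κ hκ => ?_
  have hV : ∑ ω, m ω * ∑ b, β ω b * U b ω = ∑ a, ∑ ω, m ω * β ω a * U a ω := by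
    rw [Finset.sum_comm]
    simp_rw [Finset.mul_sum, mul_assoc]
  rw [hV, separableCost, informativeness, Finset.mul_sum, ← Finset.sum_add_distrib]
  refine Finset.sum_le_sum fun a _ => ?_
  have : (⨆ b, ∑ ω, m ω * β ω a * (U b ω + κ * c b ω)) ≤ ∑ ω, m ω * β ω a * U a ω -
      κ * ∑ ω, (m ω * β ω a) ^ 2 / signalProb m β a :=
    ciSup_le fun b => by linarith [hκ a b]
  linarith

/-- For `s ≤ 1` this rescaling fixes nonnegative values and shrinks negative ones, so it stays above
the identity. -/
lemma strictMono_max_mul {s : ℝ} (hs : 0 < s) : StrictMono fun d : ℝ => max d (s * d) :=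
  fun _ _ h => max_lt_max h (mul_lt_mul_of_pos_left h hs)

/-- An obedient and separated recommendation rule that loses at most `η < ε` relative to full
information is optimal for some strictly monotone cost function with values in `[0, ε]`. -/
lemma exists_cost [Nonempty B] [DecidableEq B] (hm : ∀ ω, 0 ≤ m ω) (hm1 : ∑ ω, m ω = 1) (U : B → Ω → ℝ)
    (β : Ω → stdSimplex ℝ B) (hobed : ∀ a, IsBestAfter m U β a a)
    (hsep : ∀ a a' b, 0 < signalProb m β a → 0 < signalProb m β a' → IsBestAfter m U β a b →
      IsBestAfter m U β a' b → ∀ ω, m ω * β ω a * signalProb m β a' =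
        m ω * β ω a' * signalProb m β a)
    {η ε : ℝ} (hη : ∑ ω, m ω * (⨆ b, U b ω) ≤ ∑ ω, m ω * ∑ b, β ω b * U b ω + η) (hηε : η < ε)
    (g : B → stdSimplex ℝ X) (r : X → stdSimplex ℝ B)
    (hgr : ∀ b, mix (g b) r = stdSimplex.vertex b) :
    ∃ C : (Ω → stdSimplex ℝ X) → ℝ, (∀ ξ, 0 ≤ C ξ) ∧ (∃ ξ, C ξ = 0) ∧ (∀ ξ, C ξ ≤ ε) ∧
      (∀ ξ ξ', (∃ k, IsGarbling m ξ ξ' k) → C ξ' ≤ C ξ ∧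
        ((¬ ∃ k, IsGarbling m ξ' ξ k) → C ξ' < C ξ)) ∧
      ∀ ξ σ, ∑ ω, m ω * ∑ b, mix (ξ ω) σ b * U b ω - C ξ ≤
        ∑ ω, m ω * ∑ b, β ω b * U b ω - C fun ω => mix (β ω) g := by
  classical
  obtain ⟨c, hc1, hc2, hc3⟩ := exists_penalty hm U β hsep
  set V := ∑ ω, m ω * ∑ b, β ω b * U b ω with hV
  obtain ⟨κ, ⟨hκV, hκε⟩, hκ⟩ : ∃ κ, (separableCost m U c κ β ≤ V ∧ κ < (ε - η) / 4) ∧ 0 < κ :=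
    (((eventually_separableCost_le hm U c β hobed hc3).and
      (nhdsWithin_le_nhds (Iio_mem_nhds (show (0 : ℝ) < (ε - η) / 4 by linarith)))).and
      self_mem_nhdsWithin).exists
  obtain ⟨b₀⟩ := ‹Nonempty B›
  obtain ⟨x₀⟩ : Nonempty X := by
    by_contra h
    rw [not_nonempty_iff] at h
    have := stdSimplex.sum_eq_one (g b₀)
    simp at this
  have hBne : Nonempty B := ⟨b₀⟩
  have hXne : Nonempty X := ⟨x₀⟩
  set D : (Ω → stdSimplex ℝ X) → ℝ := fun ξ => separableCost m U c κ ξ - V with hD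
  set ξ₀ : Ω → stdSimplex ℝ X := fun _ => stdSimplex.vertex x₀
  set ξs : Ω → stdSimplex ℝ X := fun ω => mix (β ω) g with hξs
  -- The uninformative experiment is a garbling of every experiment, hence minimizes `D`; it will
  -- have cost zero.
  have hlow : ∀ ξ : Ω → stdSimplex ℝ X, IsGarbling m ξ ξ₀ fun _ => stdSimplex.vertex x₀ :=
      fun ξ x ω _ => by
    rw [← Finset.mul_sum, stdSimplex.sum_eq_one (ξ ω), mul_one]
  have hDmono : ∀ ξ ξ', (∃ k, IsGarbling m ξ ξ' k) → D ξ' ≤ D ξ ∧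
      ((¬ ∃ k, IsGarbling m ξ' ξ k) → D ξ' < D ξ) := by
    rintro ξ ξ' ⟨k, hk⟩
    have h1 := hk.separableCost_le hm U c κ
    have h2 := mul_nonneg hκ.le (sub_nonneg.2 (hk.informativeness_le hm))
    refine ⟨by simp only [hD]; linarith, fun hnot => ?_⟩
    have h3 : informativeness m ξ' < informativeness m ξ := by
      by_contra hle
      exact hnot (hk.exists_reverse hm (not_lt.1 hle))
    have h4 := mul_pos hκ (sub_pos.2 h3)
    simp only [hD]
    linarith
  have hval : ∀ ξ σ, ∑ ω, m ω * ∑ b, mix (ξ ω) σ b * U b ω ≤ D ξ + V := fun ξ σ => by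
    simp only [hD, sub_add_cancel]
    exact value_le_separableCost hm U c hκ.le hc2 ξ σ
  have hDs : D ξs ≤ 0 := by
    have hgar : IsGarbling m β ξs g := fun x ω _ => rfl
    have h1 := hgar.separableCost_le hm U c κ
    have h2 := mul_nonneg hκ.le (sub_nonneg.2 (hgar.informativeness_le hm))
    simp only [hD]
    linarith
  have hDs' : 0 ≤ D ξs := by
    have := hval ξs r
    simp only [hξs, mix_mix, hgr, mix_vertex] at this
    linarith
  have hDup : ∀ ξ, D ξ ≤ η + 2 * κ := fun ξ => by
    have := separableCost_le hm hm1 U c hκ.le hc1 ξ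
    simp only [hD]
    linarith
  -- `D ξ₀` may be very negative. Shrinking it limits the shift needed for nonnegativity to `(ε - η)
  -- / 2`, while `2 * κ` uses up the other half of the slack.
  obtain ⟨s, hs0, hs1, hsε⟩ : ∃ s : ℝ, 0 < s ∧ s ≤ 1 ∧ s * |D ξ₀| ≤ (ε - η) / 2 := by
    refine ⟨min 1 ((ε - η) / 2 / (|D ξ₀| + 1)), lt_min one_pos (div_pos (by linarith)
      (by positivity)), min_le_left _ _, ?_⟩
    calc _ ≤ (ε - η) / 2 / (|D ξ₀| + 1) * (|D ξ₀| + 1) :=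
          mul_le_mul (min_le_right _ _) (by linarith) (abs_nonneg _)
            (div_nonneg (by linarith) (by positivity))
      _ = _ := div_mul_cancel₀ _ (by positivity)
  set h : ℝ → ℝ := fun d => max d (s * d)
  have hmono : StrictMono h := strictMono_max_mul hs0
  refine ⟨fun ξ => h (D ξ) - h (D ξ₀), fun ξ => ?_, ⟨ξ₀, sub_self _⟩, fun ξ => ?_,
    fun ξ ξ' hk => ⟨?_, fun hnot => ?_⟩, fun ξ σ => ?_⟩
  · exact sub_nonneg.2 (hmono.monotone (hDmono ξ ξ₀ ⟨_, hlow ξ⟩).1)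
  · have h1 : h (D ξ) ≤ η + 2 * κ := by
      have h2 : 0 ≤ η + 2 * κ := hDs'.trans (hDup ξs)
      refine max_le (hDup ξ) ?_
      rcases le_total 0 (D ξ) with h3 | h3
      · exact (mul_le_of_le_one_left h3 hs1).trans (hDup ξ)
      · exact (mul_nonpos_of_nonneg_of_nonpos hs0.le h3).trans h2
    have h4 : s * D ξ₀ ≤ h (D ξ₀) := le_max_right _ _
    have h5 : -(s * |D ξ₀|) ≤ s * D ξ₀ := by
      rw [← mul_neg]
      exact mul_le_mul_of_nonneg_left (neg_abs_le _) hs0.le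
    linarith
  · exact sub_le_sub_right (hmono.monotone (hDmono ξ ξ' hk).1) _
  · exact sub_lt_sub_right (hmono ((hDmono ξ ξ' hk).2 hnot)) _
  · have h1 := hval ξ σ
    have h2 : D ξ ≤ h (D ξ) := le_max_left _ _
    -- The rescaling preserves optimality: `ξs` sits at level zero, and all other levels are only
    -- raised.
    have h3 : h (D ξs) ≤ 0 := max_le hDs (mul_nonpos_of_nonneg_of_nonpos hs0.le hDs)
    linarith

end SingleAgent

/-- A separated Bayes correlated equilibrium in which players mix independently conditional on a
correlation state, with small expected losses relative to full information, is the outcome of an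
equilibrium with small information costs. -/
lemma BaseGame.IsDecomposition.exists_technology {G : BaseGame I Θ A} {Z : Type} [Fintype Z]
    {q : (∀ j, A j) × Θ → ℝ} {η ε : ℝ} {ζ : Θ → stdSimplex ℝ Z}
    {α : Z → Θ → ∀ j, stdSimplex ℝ (A j)} (h : G.IsDecomposition q η ζ α)
    (hsep : G.IsSeparatedBCE q) (hηε : η < ε) :
    ∃ T : Technology Θ A, T.IsUnconstrainedRI ∧
      ∃ (ξ : ∀ j, T.Experiment j) (σ : ∀ j, T.Plan j), IsEquilibrium G T ξ σ ∧
        (∀ i, ∀ ξi ∈ T.feasible i, T.cost i ξi ≤ ε) ∧ outcomeOf G T ξ σ = q := by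
  classical
  have hq := h.outcome
  have hne : ∀ i, Nonempty (A i) := G.nonempty_action hsep.1.1
  have hbce := ((G.isBCE_iff).1 hsep.1).2
  -- One signal space, large enough for both cardinality requirements and for all players.
  set N : ℕ := ∑ i, Fintype.card (A i) + Fintype.card (Z × Θ) + 1
  have hcard : ∀ i, Fintype.card (A i) < Fintype.card (Fin N) := fun i => by
    have := Finset.single_le_sum (f := fun i => Fintype.card (A i)) (fun _ _ => Nat.zero_le _)
      (Finset.mem_univ i)
    rw [Fintype.card_fin]
    omega
  have e : ∀ i, A i ↪ Fin N := fun i =>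
    Classical.choice (Function.Embedding.nonempty_of_card_le (hcard i).le)
  have hr : ∀ i y, Function.invFun (e i) (e i y) = y := fun i =>
    Function.leftInverse_invFun (e i).injective
  let g : ∀ i, A i → stdSimplex ℝ (Fin N) := fun i y => stdSimplex.vertex (e i y)
  let r : ∀ i, Fin N → stdSimplex ℝ (A i) := fun i s =>
    stdSimplex.vertex (Function.invFun (e i) s)
  have hgr : ∀ i b, mix (g i b) (r i) = stdSimplex.vertex b := fun i b => by
    simp only [g, r]
    rw [vertex_mix, hr]
  let m : Z × Θ → ℝ := fun zθ => ζ zθ.2 zθ.1 * G.prior zθ.2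
  have hm : ∀ zθ, 0 ≤ m zθ := fun zθ => mul_nonneg (stdSimplex.zero_le _ _) (G.prior_pos _).le
  have hm1 : ∑ zθ, m zθ = 1 := by
    rw [Fintype.sum_prod_type_right]
    simp only [m]
    simp_rw [← Finset.sum_mul, stdSimplex.sum_eq_one, one_mul, G.prior_sum]
  let U : ∀ i, A i → Z × Θ → ℝ := fun i b zθ =>
    G.actionValue i (fun j => α zθ.1 zθ.2 j) zθ.2 b
  let β : ∀ i, Z × Θ → stdSimplex ℝ (A i) := fun i zθ => α zθ.1 zθ.2 i
  have hrec : ∀ i a b, ∑ zθ, m zθ * β i zθ a * U i b zθ = G.recommendationValue q i a b := by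
    intro i a b
    rw [BaseGame.recommendationValue, BaseGame.sum_value_of_mixture hq, Fintype.sum_prod_type]
  have hsig : ∀ i a, signalProb m (β i) a = actionProb q i a := by
    intro i a
    rw [BaseGame.actionProb_of_mixture hq, signalProb, Fintype.sum_prod_type]
  have hbest : ∀ i a b, a ∈ suppAct q i →
      (IsBestAfter m (U i) (β i) a b ↔ b ∈ G.bestResponses i (cond q i a)) := by
    intro i a b ha
    rw [G.mem_bestResponses_cond_iff ha]
    simp_rw [IsBestAfter, hrec]
    rfl
  have hC : ∀ i, ∃ C : (Z × Θ → stdSimplex ℝ (Fin N)) → ℝ, (∀ ξ, 0 ≤ C ξ) ∧ (∃ ξ, C ξ = 0) ∧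
      (∀ ξ, C ξ ≤ ε) ∧ (∀ ξ ξ', (∃ k, IsGarbling m ξ ξ' k) → C ξ' ≤ C ξ ∧
        ((¬ ∃ k, IsGarbling m ξ' ξ k) → C ξ' < C ξ)) ∧
      ∀ ξ σ, ∑ ω, m ω * ∑ b, mix (ξ ω) σ b * U i b ω - C ξ ≤
        ∑ ω, m ω * ∑ b, β i ω b * U i b ω - C fun ω => mix (β i ω) (g i) := by
    intro i
    refine exists_cost hm hm1 (U i) (β i) (fun a b => ?_) (fun a a' b ha ha' hab hab' zθ => ?_)
      (η := η) ?_ hηε (g i) (r i) (hgr i)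
    · rw [hrec, hrec]
      exact hbce i a b
    · rw [hsig] at ha ha' ⊢
      rw [hsig]
      -- Separation turns a common best response into equal conditionals; the decomposition then
      -- makes the two recommendations proportional at every state.
      have hcond : cond q i a = cond q i a' := by
        by_contra hne'
        have hempty := hsep.2 i a ha a' ha' hne'
        exact Set.notMem_empty b (hempty ▸ ⟨(hbest i a b ha).1 hab, (hbest i a' b ha').1 hab'⟩)
      rcases (stdSimplex.zero_le (ζ zθ.2) zθ.1).eq_or_lt with h0 | h0
      · simp [m, ← h0]
      · have := h.proportional i a ha a' ha' hcond zθ.1 zθ.2 h0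
        simp only [β]
        rw [mul_assoc, this, ← mul_assoc]
    · have := h.regret_le i
      simp_rw [BaseGame.regret, mul_sub, Finset.sum_sub_distrib] at this
      rw [Fintype.sum_prod_type, Fintype.sum_prod_type]
      simp only [m, U, β]
      linarith
  choose C hC0 hCz hCε hCm hCopt using hC
  let T : Technology Θ A :=
    { Z := Z
      X := fun _ => Fin N
      ζ := ζ
      feasible := fun _ => Set.univ
      cost := C
      card_action_lt := hcard
      card_state_lt := fun i => by
        rw [Fintype.card_fin]
        omega
      cost_nonneg := fun i ξ _ => hC0 i ξ
      exists_cost_zero := fun i => (hCz i).imp fun ξ hξ => ⟨Set.mem_univ _, hξ⟩ }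
  let ξ : ∀ j, T.Experiment j := fun j zθ => mix (β j zθ) (g j)
  let σ : ∀ j, T.Plan j := r
  have hmix : ∀ j zθ, mix (ξ j zθ) (σ j) = β j zθ := fun j zθ => by
    simp only [ξ, σ]
    change mix (mix (β j zθ) (g j)) (r j) = _
    rw [mix_mix]
    simp_rw [hgr, mix_vertex]
  have hpay : ∀ i (ξi : T.Experiment i) (σi : T.Plan i), payoff G T i ξi σi ξ σ =
      ∑ ω, m ω * ∑ b, mix (ξi ω) σi b * U i b ω - C i ξi := by
    intro i ξi σi
    rw [payoff_eq]
    simp_rw [hmix]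
    congr 1
    exact (Fintype.sum_prod_type fun ω => m ω * ∑ b, mix (ξi ω) σi b * U i b ω).symm
  refine ⟨T, fun i => ⟨rfl, fun ξ₁ _ ξ₂ _ hdom => ?_⟩, ξ, σ, fun i => ⟨Set.mem_univ _,
    fun ξi _ σi => ?_⟩, fun i ξi _ => hCε i ξi, ?_⟩
  · rw [T.dominates_iff G] at hdom
    rw [T.dominates_iff G i ξ₂ ξ₁]
    exact hCm i ξ₁ ξ₂ hdom
  · rw [hpay, hpay]
    simp_rw [hmix]
    exact hCopt i ξi σi
  · funext ⟨a, θ⟩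
    rw [outcomeOf_apply, hq]
    simp_rw [hmix]
    rfl

/-! ### Limits of convex combinations -/

/-- By Carathéodory a fixed number of points suffices, so the hull is a continuous image of a
simplex times a power of `K`. Shorter combinations are padded by weight zero at `k₀`. -/
lemma _root_.IsCompact.convexHull_of_finiteDimensional {E : Type*} [NormedAddCommGroup E]
    [NormedSpace ℝ E] [FiniteDimensional ℝ E] {K : Set E} (hK : IsCompact K) :
    IsCompact (convexHull ℝ K) := by
  classical
  rcases K.eq_empty_or_nonempty with rfl | ⟨k₀, hk₀⟩
  · simp
  set d := Module.finrank ℝ E + 1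
  have himage : convexHull ℝ K = (fun wz : (Fin d → ℝ) × (Fin d → E) => ∑ i, wz.1 i • wz.2 i) ''
      (stdSimplex ℝ (Fin d) ×ˢ Set.univ.pi fun _ => K) := by
    apply Set.Subset.antisymm
    · intro x hx
      obtain ⟨ι, _, z, w, hz, hind, hw, hw1, hx⟩ := eq_pos_convex_span_of_mem_convexHull hx
      obtain ⟨e⟩ : Nonempty (ι ↪ Fin d) := Function.Embedding.nonempty_of_card_le (by
        rw [Fintype.card_fin]
        exact hind.card_le_finrank_succ.trans
          (Nat.succ_le_succ (Submodule.finrank_le _)))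
      have hout : ∀ j ∉ Set.range e, Function.extend e w 0 j = 0 := fun j hj =>
        Function.extend_apply' _ _ _ hj
      refine ⟨(Function.extend e w 0, Function.extend e z fun _ => k₀), ⟨⟨fun j => ?_, ?_⟩,
        fun j _ => ?_⟩, ?_⟩
      · by_cases hj : j ∈ Set.range e
        · obtain ⟨i, rfl⟩ := hj
          simp only [e.injective.extend_apply]
          exact (hw i).le
        · exact (hout j hj).ge
      · rw [← hw1]
        exact (Fintype.sum_of_injective e e.injective w _ hout
          fun i => (e.injective.extend_apply _ _ i).symm).symm
      · by_cases hj : j ∈ Set.range e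
        · obtain ⟨i, rfl⟩ := hj
          simp only [e.injective.extend_apply]
          exact hz ⟨i, rfl⟩
        · simp only
          rw [Function.extend_apply' _ _ _ hj]
          exact hk₀
      · rw [← hx]
        refine (Fintype.sum_of_injective e e.injective _ _ (fun j hj => ?_) fun i => ?_).symm
        · simp only [hout j hj, zero_smul]
        · simp only [e.injective.extend_apply]
    · rintro _ ⟨⟨w, z⟩, ⟨hw, hz⟩, rfl⟩
      exact (convex_convexHull ℝ K).sum_mem (fun i _ => hw.1 i) hw.2
        fun i _ => subset_convexHull ℝ K (hz i (Set.mem_univ i))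
  rw [himage]
  exact ((isCompact_stdSimplex ℝ _).prod (isCompact_univ_pi fun _ => hK)).image (by fun_prop)

/-- A limit of averages of `f` under which the average of `r ≥ 0` vanishes is an average of `f`
over the zeros of `r`. -/
lemma mem_convexHull_image_zero_of_tendsto {K E : Type*} [TopologicalSpace K] [CompactSpace K]
    [NormedAddCommGroup E] [NormedSpace ℝ E] [FiniteDimensional ℝ E] {f : K → E} {r : K → ℝ}
    (hf : Continuous f) (hr : Continuous r) (hr0 : ∀ k, 0 ≤ r k) {x : ℕ → E} {x₀ : E}
    (hx : Filter.Tendsto x Filter.atTop (𝓝 x₀)) {δ : ℕ → ℝ}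
    (hδ : Filter.Tendsto δ Filter.atTop (𝓝 0))
    (h : ∀ n, ∃ (Z : Type) (_ : Fintype Z) (μ : stdSimplex ℝ Z) (k : Z → K),
      ∑ z, μ z • f (k z) = x n ∧ ∑ z, μ z * r (k z) ≤ δ n) :
    x₀ ∈ convexHull ℝ (f '' {k | r k = 0}) := by
  set F : K → E × ℝ := fun k => (f k, r k)
  have hcomp : IsCompact (convexHull ℝ (Set.range F)) :=
    (isCompact_range (hf.prodMk hr)).convexHull_of_finiteDimensional
  choose Z hZ μ k hk1 hk2 using h
  have hmem : ∀ n, (x n, ∑ z, μ n z * r (k n z)) ∈ convexHull ℝ (Set.range F) := by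
    intro n
    have : (x n, ∑ z, μ n z * r (k n z)) = ∑ z, μ n z • F (k n z) := by
      rw [← hk1 n]
      ext
      · simp [F, Prod.fst_sum]
      · simp [F, Prod.snd_sum]
    rw [this]
    exact (convex_convexHull ℝ _).sum_mem (fun z _ => stdSimplex.zero_le _ _)
      (stdSimplex.sum_eq_one _) fun z _ => subset_convexHull ℝ _ ⟨_, rfl⟩
  have hlim : Filter.Tendsto (fun n => (x n, ∑ z, μ n z * r (k n z))) Filter.atTop
      (𝓝 (x₀, (0 : ℝ))) := by
    refine hx.prodMk_nhds (squeeze_zero (fun n => ?_) hk2 hδ)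
    exact Finset.sum_nonneg fun z _ => mul_nonneg (stdSimplex.zero_le _ _) (hr0 _)
  have hmem₀ := hcomp.isClosed.mem_of_tendsto hlim (Filter.Eventually.of_forall hmem)
  obtain ⟨ι, _, z, w, hz, -, hw, hw1, hsum⟩ := eq_pos_convex_span_of_mem_convexHull hmem₀
  choose κ hκ using fun i => hz ⟨i, rfl⟩
  have h1 : ∑ i, w i • f (κ i) = x₀ := by
    have := congrArg Prod.fst hsum
    simpa [Prod.fst_sum, ← hκ, F] using this
  have h2 : ∑ i, w i * r (κ i) = 0 := by
    have := congrArg Prod.snd hsum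
    simpa [Prod.snd_sum, ← hκ, F] using this
  rw [Finset.sum_eq_zero_iff_of_nonneg fun i _ => mul_nonneg (hw i).le (hr0 _)] at h2
  rw [← h1]
  refine (convex_convexHull ℝ _).sum_mem (fun i _ => (hw i).le) hw1 fun i _ =>
    subset_convexHull ℝ _ ⟨κ i, ?_, rfl⟩
  exact (mul_eq_zero.1 (h2 i (Finset.mem_univ i))).resolve_left (hw i).ne'

/-! ### Mixtures of complete-information Nash equilibria -/

namespace BaseGame

variable {G : BaseGame I Θ A}

variable (G) in
/-- `p` is the mixture, with positive weights `s`, of the outcomes in which players mix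
independently according to `α l θ` conditional on `θ`; these are Nash equilibria given each `θ` and
agree with `p` on the relative frequencies of actions in the same cell. -/
structure IsNashMixture {ι : Type*} [Fintype ι] (P : ProductPartition A)
    (p : (∀ j, A j) × Θ → ℝ) (s : ι → ℝ) (α : ι → Θ → ∀ j, stdSimplex ℝ (A j)) : Prop where
  pos : ∀ l, 0 < s l
  sum_eq_one : ∑ l, s l = 1
  eq_sum : ∀ a θ, p (a, θ) = ∑ l, s l * (G.prior θ * ∏ j, α l θ j (a j))
  regret_eq_zero : ∀ l θ i, G.regret i (fun j => α l θ j) θ = 0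
  proportional : ∀ l θ i x x', P i x x' →
    α l θ i x * actionProb p i x' = α l θ i x' * actionProb p i x

lemma actionProb_of_indep {q : (∀ j, A j) × Θ → ℝ} {α : Θ → ∀ j, stdSimplex ℝ (A j)}
    (hq : ∀ a θ, q (a, θ) = G.prior θ * ∏ j, α θ j (a j)) (i : I) (x : A i) :
    actionProb q i x = ∑ θ, G.prior θ * α θ i x := by
  have := actionProb_of_mixture (G := G) (Z := Unit) (ζ := fun _ => stdSimplex.vertex ())
    (α := fun _ => α) (q := q) (by simpa using hq) i x
  simpa using this

/-- The ratios in a cell are the same at every `θ`, so they survive averaging over `θ`. Positive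
weights put the support of each component inside that of `p`, which justifies the cancellation. -/
lemma IsNashMixture.exists_decomposable {L : ℕ} {P : ProductPartition A}
    {p : (∀ j, A j) × Θ → ℝ} {s : Fin L → ℝ} {α : Fin L → Θ → ∀ j, stdSimplex ℝ (A j)}
    (h : G.IsNashMixture P p s α) :
    ∃ (L : ℕ) (s : Fin L → ℝ) (q : Fin L → (∀ i, A i) × Θ → ℝ),
      (∀ l, 0 ≤ s l) ∧ ∑ l, s l = 1 ∧
      (∀ l, G.IsCompleteInfoNash (q l) ∧ IsDecomposable P p (q l)) ∧ p = ∑ l, s l • q l := by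
  let q : Fin L → (∀ i, A i) × Θ → ℝ := fun l aθ => G.prior aθ.2 * ∏ j, α l aθ.2 j (aθ.1 j)
  have hq : ∀ l a θ, q l (a, θ) = G.prior θ * ∏ j, α l θ j (a j) := fun _ _ _ => rfl
  have hpsum : p = ∑ l, s l • q l := by
    funext ⟨a, θ⟩
    rw [h.eq_sum]
    simp [q]
  have hpq : ∀ l i x, s l * actionProb (q l) i x ≤ actionProb p i x := by
    intro l i x
    simp_rw [actionProb, Finset.mul_sum]
    refine Finset.sum_le_sum fun y _ => Finset.sum_le_sum fun θ _ => ?_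
    rw [h.eq_sum]
    exact Finset.single_le_sum (f := fun l => s l * (G.prior θ * ∏ j, α l θ j (combine i x y j)))
      (fun l _ => mul_nonneg (h.pos l).le (mul_nonneg (G.prior_pos θ).le
        (Finset.prod_nonneg fun j _ => stdSimplex.zero_le _ _))) (Finset.mem_univ l)
  refine ⟨L, s, q, fun l => (h.pos l).le, h.sum_eq_one, fun l => ⟨⟨?_, fun θ => ⟨α l θ,
    fun a => ?_, fun i => (G.regret_eq_zero_iff i (α l θ) θ).1 (h.regret_eq_zero l θ i)⟩⟩, ?_, ?_⟩,
    hpsum⟩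
  · exact mem_outcomes_of_mixture (Z := Unit) (ζ := fun _ => stdSimplex.vertex ())
      (α := fun _ => α l) (by simpa using hq l)
  · rw [hq, mul_div_cancel_left₀ _ (G.prior_pos θ).ne']
  · intro i x x' hxx hx hx'
    have hpx : 0 < actionProb p i x := (mul_pos (h.pos l) hx).trans_le (hpq l i x)
    have hpx' : 0 < actionProb p i x' := (mul_pos (h.pos l) hx').trans_le (hpq l i x')
    have hprop := h.proportional l (i := i) (x := x) (x' := x') (P := P)
    have e1 : actionProb (q l) i x * actionProb p i x' =
        actionProb (q l) i x' * actionProb p i x := by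
      rw [actionProb_of_indep (hq l), actionProb_of_indep (hq l), Finset.sum_mul, Finset.sum_mul]
      refine Finset.sum_congr rfl fun θ _ => ?_
      rw [mul_assoc, hprop θ hxx, mul_assoc]
    rw [cond_eq_cond_iff hx hx']
    intro y θ
    rw [hq, hq, prod_combine i x y fun j => α l θ j, prod_combine i x' y fun j => α l θ j]
    have e2 := hprop θ hxx
    refine mul_right_cancel₀ hpx.ne' ?_
    calc _ = G.prior θ * (∏ j : {j // j ≠ i}, α l θ j (y j)) * α l θ i x *
          (actionProb (q l) i x' * actionProb p i x) := by ring
      _ = G.prior θ * (∏ j : {j // j ≠ i}, α l θ j (y j)) *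
          (α l θ i x * actionProb p i x') * actionProb (q l) i x := by rw [← e1]; ring
      _ = _ := by rw [e2]; ring
  · intro i x x' hxx
    rw [actionProb_of_indep (hq l), actionProb_of_indep (hq l), Finset.sum_mul, Finset.mul_sum]
    refine Finset.sum_congr rfl fun θ _ => ?_
    rw [mul_assoc, h.proportional l θ i x x' hxx]
    ring

/-- In a decomposable complete-information outcome, actions in the same cell are played with the
relative frequencies that they have in `p`. -/
lemma proportional_of_isDecomposable {P : ProductPartition A} {p q : (∀ j, A j) × Θ → ℝ}
    {α : Θ → ∀ j, stdSimplex ℝ (A j)}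
    (hq : ∀ a θ, q (a, θ) = G.prior θ * ∏ j, α θ j (a j)) (h : IsDecomposable P p q) (θ : Θ)
    (i : I) {x x' : A i} (hxx : P i x x') :
    α θ i x * actionProb p i x' = α θ i x' * actionProb p i x := by
  have hzero : ∀ y : A i, y ∉ suppAct q i → α θ i y = 0 := by
    intro y hy
    have h0 : ∑ θ, G.prior θ * α θ i y = 0 := by
      rw [← actionProb_of_indep hq]
      refine eq_zero_of_notMem_suppAct (fun ⟨a, θ⟩ => ?_) hy
      rw [hq]
      exact mul_nonneg (G.prior_pos θ).le (Finset.prod_nonneg fun j _ => stdSimplex.zero_le _ _)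
    rw [Finset.sum_eq_zero_iff_of_nonneg fun θ _ =>
      mul_nonneg (G.prior_pos θ).le (stdSimplex.zero_le _ _)] at h0
    exact (mul_eq_zero.1 (h0 θ (Finset.mem_univ θ))).resolve_left (G.prior_pos θ).ne'
  have hdec := h.2 i x x' hxx
  have hq0 : ∀ y : A i, y ∉ suppAct q i → actionProb q i y = 0 := fun y =>
    eq_zero_of_notMem_suppAct (fun ⟨a, θ⟩ => by
      rw [hq]
      exact mul_nonneg (G.prior_pos θ).le (Finset.prod_nonneg fun j _ => stdSimplex.zero_le _ _))
  by_cases hx : x ∈ suppAct q i <;> by_cases hx' : x' ∈ suppAct q i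
  · have hc := (cond_eq_cond_iff hx hx').1 (h.1 i x x' hxx hx hx')
    have hsum : ∑ y : Others A i, q (combine i x y, θ) * actionProb q i x' =
        ∑ y : Others A i, q (combine i x' y, θ) * actionProb q i x :=
      Finset.sum_congr rfl fun y _ => hc y θ
    have hmarg : ∀ z : A i, ∑ y : Others A i, q (combine i z y, θ) = G.prior θ * α θ i z := by
      intro z
      simp_rw [hq, fun y => prod_combine i z y fun j => α θ j, ← Finset.mul_sum, sum_prod_others,
        mul_one]
    rw [← Finset.sum_mul, ← Finset.sum_mul, hmarg, hmarg, mul_assoc, mul_assoc] at hsum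
    have hα := mul_left_cancel₀ (G.prior_pos θ).ne' hsum
    have hxpos : 0 < actionProb q i x' := hx'
    refine mul_right_cancel₀ hxpos.ne' ?_
    linear_combination actionProb p i x' * hα + α θ i x' * hdec
  · rw [hq0 x' hx', mul_zero] at hdec
    rw [hzero x' hx', zero_mul]
    have hxpos : 0 < actionProb q i x := hx
    rw [(mul_eq_zero.1 hdec).resolve_left hxpos.ne', mul_zero]
  · rw [hq0 x hx, zero_mul] at hdec
    rw [hzero x hx, zero_mul]
    have hxpos : 0 < actionProb q i x' := hx'
    rw [(mul_eq_zero.1 hdec.symm).resolve_right hxpos.ne', mul_zero]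
  · rw [hzero x hx, hzero x' hx', zero_mul, zero_mul]

lemma exists_isNashMixture {L : ℕ} {P : ProductPartition A} {p : (∀ j, A j) × Θ → ℝ}
    {s : Fin L → ℝ} {q : Fin L → (∀ i, A i) × Θ → ℝ} (hs : ∀ l, 0 ≤ s l) (hs1 : ∑ l, s l = 1)
    (hq : ∀ l, G.IsCompleteInfoNash (q l) ∧ IsDecomposable P p (q l)) (hp : p = ∑ l, s l • q l) :
    ∃ (L : ℕ) (s : Fin L → ℝ) (α : Fin L → Θ → ∀ j, stdSimplex ℝ (A j)),
      G.IsNashMixture P p s α := by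
  classical
  choose α hα hnash using fun l θ => (hq l).1.2 θ
  have hq' : ∀ l a θ, q l (a, θ) = G.prior θ * ∏ j, α l θ j (a j) := fun l a θ => by
    rw [← hα, mul_div_cancel₀ _ (G.prior_pos θ).ne']
  -- Components of weight zero are dropped, since `IsNashMixture` asks for positive weights.
  let e := (Fintype.equivFin {l // 0 < s l}).symm
  have hsum : ∀ f : Fin L → ℝ, ∑ k, s (e k) * f (e k) = ∑ l, s l * f l := by
    intro f
    rw [e.sum_comp fun l : {l // 0 < s l} => s l * f l]
    refine Fintype.sum_of_injective Subtype.val Subtype.val_injective _ _ (fun l hl => ?_)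
      fun _ => rfl
    rw [Subtype.range_coe_subtype] at hl
    rw [le_antisymm (not_lt.1 hl) (hs l), zero_mul]
  refine ⟨_, fun k => s (e k), fun k => α (e k), fun k => (e k).2, ?_, fun a θ => ?_,
    fun k θ i => (G.regret_eq_zero_iff i _ θ).2 (hnash _ θ i), fun k θ i x x' hxx =>
    proportional_of_isDecomposable (hq' _) (hq _).2 θ i hxx⟩
  · simpa [hs1] using hsum fun _ => 1
  · rw [hsum fun l => G.prior θ * ∏ j, α l θ j (a j), hp]
    simp [hq']

/-- Proportionality is exact for the frequencies of the approximating outcome; this bounds the error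
when those of the limit `p` are used instead. -/
lemma abs_cross_sub_le {a b c d c' d' : ℝ} (ha0 : 0 ≤ a) (ha1 : a ≤ 1) (hb0 : 0 ≤ b)
    (hb1 : b ≤ 1) (h : a * d' = b * c') : |a * d - b * c| ≤ |d - d'| + |c - c'| := by
  have h1 : a * d - b * c = a * (d - d') - b * (c - c') := by linear_combination h
  rw [h1]
  refine (abs_sub _ _).trans (add_le_add ?_ ?_)
  · rw [abs_mul, abs_of_nonneg ha0]
    exact mul_le_of_le_one_left (abs_nonneg _) ha1
  · rw [abs_mul, abs_of_nonneg hb0]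
    exact mul_le_of_le_one_left (abs_nonneg _) hb1

/-- A limit of outcomes that decompose with vanishing losses is a mixture of complete-information
Nash equilibria. -/
lemma exists_isNashMixture_of_tendsto {P : ProductPartition A} {p : (∀ j, A j) × Θ → ℝ}
    {q : ℕ → (∀ j, A j) × Θ → ℝ} {ε : ℕ → ℝ} (hε : Filter.Tendsto ε Filter.atTop (𝓝 0))
    (hq : ∀ n, ∃ (Z : Type) (_ : Fintype Z) (ζ : Θ → stdSimplex ℝ Z)
      (α : Z → Θ → ∀ j, stdSimplex ℝ (A j)), G.IsDecomposition (q n) (ε n) ζ α)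
    (hP : ∀ n, inducedPartition (q n) = P) (hlim : Filter.Tendsto q Filter.atTop (𝓝 p)) :
    ∃ (L : ℕ) (s : Fin L → ℝ) (α : Fin L → Θ → ∀ j, stdSimplex ℝ (A j)),
      G.IsNashMixture P p s α := by
  classical
  let f : (∀ j, stdSimplex ℝ (A j)) → (∀ j, A j) → ℝ := fun α a => ∏ j, α j (a j)
  -- The gap is measured with the frequencies of `p`, so that the function `r`, whose zeros are the
  -- proportional Nash profiles, does not depend on `n`.
  let gap : ∀ i, (∀ j, stdSimplex ℝ (A j)) → A i → A i → ℝ := fun i α x x' =>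
    if P i x x' then |α i x * actionProb p i x' - α i x' * actionProb p i x| else 0
  let r : Θ → (∀ j, stdSimplex ℝ (A j)) → ℝ := fun θ α =>
    ∑ i, (G.regret i (fun j => α j) θ + ∑ x, ∑ x', gap i α x x')
  have hcoe : ∀ i (x : A i), Continuous fun α : ∀ j, stdSimplex ℝ (A j) => α i x := fun i x =>
    (continuous_apply x).comp (continuous_subtype_val.comp (continuous_apply i))
  have hf : Continuous f := continuous_pi fun a => continuous_finsetProd _ fun j _ => hcoe j _
  have hr : ∀ θ, Continuous (r θ) := fun θ => continuous_finsetSum _ fun i _ => by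
    refine ((G.continuous_regret i θ).comp (continuous_pi fun j => continuous_pi fun x =>
      hcoe j x)).add (continuous_finsetSum _ fun x _ => continuous_finsetSum _ fun x' _ => ?_)
    by_cases hxx : P i x x'
    · simp only [gap, if_pos hxx]
      exact (((hcoe i x).mul continuous_const).sub ((hcoe i x').mul continuous_const)).abs
    · simpa only [gap, if_neg hxx] using continuous_const
  have hgap0 : ∀ i α x x', 0 ≤ gap i α x x' := fun i α x x' => by
    simp only [gap]
    split_ifs
    exacts [abs_nonneg _, le_rfl]
  have hpart0 : ∀ θ α i, 0 ≤ G.regret i (fun j => α j) θ + ∑ x, ∑ x', gap i α x x' :=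
    fun θ α i => add_nonneg (G.regret_nonneg i α θ)
      (Finset.sum_nonneg fun x _ => Finset.sum_nonneg fun x' _ => hgap0 i α x x')
  have hr0 : ∀ θ α, 0 ≤ r θ α := fun θ α => Finset.sum_nonneg fun i _ => hpart0 θ α i
  let dist : ℕ → ∀ i, A i → A i → ℝ := fun n i x x' =>
    |actionProb p i x' - actionProb (q n) i x'| + |actionProb p i x - actionProb (q n) i x|
  have hact : ∀ i (x : A i), Filter.Tendsto (fun n => |actionProb p i x - actionProb (q n) i x|)
      Filter.atTop (𝓝 0) := by
    intro i x
    have hc : Continuous fun p' : (∀ j, A j) × Θ → ℝ => |actionProb p i x - actionProb p' i x| := by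
      unfold actionProb
      fun_prop
    simpa [Function.comp_def] using (hc.tendsto p).comp hlim
  -- The regret bound averages over payoff states; dividing by the prior gives a bound at each
  -- single `θ`.
  let δ : Θ → ℕ → ℝ := fun θ n => ∑ i, (ε n / G.prior θ + ∑ x, ∑ x', dist n i x x')
  have hδ : ∀ θ, Filter.Tendsto (δ θ) Filter.atTop (𝓝 0) := by
    intro θ
    have : (0 : ℝ) = ∑ i, (0 / G.prior θ + ∑ x : A i, ∑ x' : A i, ((0 : ℝ) + 0)) := by simp
    rw [this]
    exact tendsto_finsetSum _ fun i _ => (hε.div_const _).add (tendsto_finsetSum _ fun x _ =>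
      tendsto_finsetSum _ fun x' _ => (hact i x').add (hact i x))
  have hconv : ∀ θ, (fun a => p (a, θ) / G.prior θ) ∈ convexHull ℝ (f '' {α | r θ α = 0}) := by
    intro θ
    refine mem_convexHull_image_zero_of_tendsto hf (hr θ) (hr0 θ)
      (x := fun n a => q n (a, θ) / G.prior θ) ?_ (hδ θ) fun n => ?_
    · rw [tendsto_pi_nhds] at hlim ⊢
      exact fun a => (hlim (a, θ)).div_const _
    obtain ⟨Z, hZ, ζ, α, hd⟩ := hq n
    refine ⟨Z, hZ, ζ θ, fun z => α z θ, ?_, ?_⟩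
    · funext a
      rw [hd.outcome, Finset.sum_apply, Finset.sum_div]
      refine Finset.sum_congr rfl fun z _ => ?_
      rw [Pi.smul_apply, smul_eq_mul]
      field_simp [(G.prior_pos θ).ne']
      rfl
    have hq0 : ∀ aθ, 0 ≤ q n aθ := (mem_outcomes_of_mixture hd.outcome).1.1
    have hgap : ∀ i x x' z, 0 < ζ θ z → gap i (α z θ) x x' ≤ dist n i x x' := by
      intro i x x' z hz
      simp only [gap]
      split_ifs with hxx
      · refine abs_cross_sub_le (stdSimplex.zero_le _ _) (stdSimplex.le_one _ _)
          (stdSimplex.zero_le _ _) (stdSimplex.le_one _ _) ?_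
        rw [← hP n] at hxx
        rcases hxx with ⟨hx, hx', hc⟩ | ⟨hx, hx'⟩
        · exact hd.proportional i x hx x' hx' hc z θ hz
        · rw [eq_zero_of_notMem_suppAct hq0 hx, eq_zero_of_notMem_suppAct hq0 hx', mul_zero,
            mul_zero]
      · positivity
    have hreg : ∀ i, ∑ z, ζ θ z * G.regret i (fun j => α z θ j) θ ≤ ε n / G.prior θ := by
      intro i
      rw [le_div_iff₀ (G.prior_pos θ), Finset.sum_mul]
      refine le_trans ?_ (hd.regret_le i)
      refine Finset.sum_le_sum fun z _ => ?_
      have := Finset.single_le_sum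
        (f := fun θ => ζ θ z * G.prior θ * G.regret i (fun j => α z θ j) θ)
        (fun θ _ => mul_nonneg (mul_nonneg (stdSimplex.zero_le _ _) (G.prior_pos θ).le)
          (G.regret_nonneg i (α z θ) θ)) (Finset.mem_univ θ)
      linarith
    simp only [r, Finset.mul_sum]
    rw [Finset.sum_comm]
    refine Finset.sum_le_sum fun i _ => ?_
    calc _ ≤ ∑ z, (ζ θ z * G.regret i (fun j => α z θ j) θ +
          ζ θ z * ∑ x, ∑ x', dist n i x x') := by
          refine Finset.sum_le_sum fun z _ => ?_
          rw [mul_add]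
          refine add_le_add le_rfl ?_
          rcases (stdSimplex.zero_le (ζ θ) z).eq_or_lt with h0 | h0
          · rw [← h0, zero_mul, zero_mul]
          · exact mul_le_mul_of_nonneg_left (Finset.sum_le_sum fun x _ =>
              Finset.sum_le_sum fun x' _ => hgap i x x' z h0) h0.le
      _ ≤ _ := by
          rw [Finset.sum_add_distrib, ← Finset.sum_mul, stdSimplex.sum_eq_one, one_mul]
          exact add_le_add (hreg i) le_rfl
  -- The representations found so far have weights depending on `θ`. The hull of a product is the
  -- product of the hulls, which gives weights common to all payoff states.
  have hpi : (fun θ a => p (a, θ) / G.prior θ) ∈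
      convexHull ℝ (Set.univ.pi fun θ => f '' {α | r θ α = 0}) := by
    rw [convexHull_pi]
    exact fun θ _ => hconv θ
  obtain ⟨ι, _, z, w, hz, -, hw, hw1, hsum⟩ := eq_pos_convex_span_of_mem_convexHull hpi
  choose α hα0 hα using fun l θ => hz ⟨l, rfl⟩ θ (Set.mem_univ θ)
  let e := (Fintype.equivFin ι).symm
  have hzero : ∀ l θ i, G.regret i (fun j => α l θ j) θ = 0 ∧
      ∀ x x', gap i (α l θ) x x' = 0 := by
    intro l θ i
    have h1 := (Finset.sum_eq_zero_iff_of_nonneg fun i _ => hpart0 θ (α l θ) i).1 (hα0 l θ) i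
      (Finset.mem_univ i)
    rw [add_eq_zero_iff_of_nonneg (G.regret_nonneg i (α l θ) θ) (Finset.sum_nonneg fun x _ =>
      Finset.sum_nonneg fun x' _ => hgap0 i _ x x')] at h1
    refine ⟨h1.1, fun x x' => ?_⟩
    have h2 := (Finset.sum_eq_zero_iff_of_nonneg fun x _ =>
      Finset.sum_nonneg fun x' _ => hgap0 i _ x x').1 h1.2 x (Finset.mem_univ x)
    exact (Finset.sum_eq_zero_iff_of_nonneg fun x' _ => hgap0 i _ x x').1 h2 x' (Finset.mem_univ x')
  refine ⟨_, fun k => w (e k), fun k => α (e k), fun k => hw _, ?_, fun a θ => ?_,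
    fun k θ i => (hzero _ θ i).1, fun k θ i x x' hxx => ?_⟩
  · rw [e.sum_comp w, hw1]
  · rw [e.sum_comp fun l => w l * (G.prior θ * ∏ j, α l θ j (a j))]
    have h1 := congrFun (congrFun hsum θ) a
    simp only [Finset.sum_apply, Pi.smul_apply, smul_eq_mul, ← hα] at h1
    rw [eq_div_iff (G.prior_pos θ).ne', Finset.sum_mul] at h1
    rw [← h1]
    exact Finset.sum_congr rfl fun l _ => by simp only [f]; ring
  · have h1 := (hzero (e k) θ i).2 x x'
    simp only [gap, if_pos hxx, abs_eq_zero, sub_eq_zero] at h1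
    exact h1

end BaseGame

/-! ### Smoothing within cells -/

open Classical in
/-- The probability that player `i` takes an action in the cell of `x`. -/
def cellProb (P : ProductPartition A) (q : (∀ j, A j) × Θ → ℝ) (i : I) (x : A i) : ℝ :=
  ∑ b, if P i x b then actionProb q i b else 0

lemma cellProb_congr (P : ProductPartition A) (q : (∀ j, A j) × Θ → ℝ) {i : I} {x b : A i}
    (h : P i x b) : cellProb P q i x = cellProb P q i b := by
  classical
  refine Finset.sum_congr rfl fun y _ => ?_
  have : P i x y ↔ P i b y := ⟨fun h' => (P i).trans ((P i).symm h) h', fun h' => (P i).trans h h'⟩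
  by_cases hy : P i x y
  · rw [if_pos hy, if_pos (this.1 hy)]
  · rw [if_neg hy, if_neg (mt this.2 hy)]

lemma actionProb_le_cellProb {P : ProductPartition A} {q : (∀ j, A j) × Θ → ℝ}
    (hq : ∀ aθ, 0 ≤ q aθ) {i : I} {x b : A i} (h : P i x b) :
    actionProb q i b ≤ cellProb P q i x := by
  classical
  have := Finset.single_le_sum (f := fun b => if P i x b then actionProb q i b else 0)
    (fun b _ => by
      split_ifs
      exacts [actionProb_nonneg hq i b, le_rfl]) (Finset.mem_univ b)
  simp only [if_pos h] at this
  exact this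

lemma cellProb_nonneg {P : ProductPartition A} {q : (∀ j, A j) × Θ → ℝ}
    (hq : ∀ aθ, 0 ≤ q aθ) (i : I) (x : A i) : 0 ≤ cellProb P q i x :=
  (actionProb_nonneg hq i x).trans (actionProb_le_cellProb hq ((P i).refl x))

open Classical in
/-- The kernel that redraws player `i`'s action within its cell according to `q`. -/
def smoothing (P : ProductPartition A) (q : (∀ j, A j) × Θ → ℝ) (i : I) (x : A i) :
    stdSimplex ℝ (A i) :=
  -- An action whose cell has probability zero stays where it is.
  if h : (∀ b, 0 ≤ actionProb q i b) ∧ 0 < cellProb P q i x then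
    ⟨fun b => (if P i x b then actionProb q i b else 0) / cellProb P q i x, fun b => by
      refine div_nonneg ?_ h.2.le
      split_ifs
      exacts [h.1 b, le_rfl], by
      rw [← Finset.sum_div]
      exact div_self h.2.ne'⟩
  else stdSimplex.vertex x

lemma smoothing_of_not_rel (P : ProductPartition A) (q : (∀ j, A j) × Θ → ℝ) {i : I} {x b : A i}
    (h : ¬ P i x b) : smoothing P q i x b = 0 := by
  classical
  rw [smoothing]
  split_ifs with hx
  · change (if P i x b then actionProb q i b else 0) / cellProb P q i x = 0
    rw [if_neg h, zero_div]
  · have : b ≠ x := by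
      rintro rfl
      exact h ((P i).refl b)
    simp [this]

lemma smoothing_of_rel {P : ProductPartition A} {q : (∀ j, A j) × Θ → ℝ} (hq : ∀ aθ, 0 ≤ q aθ)
    {i : I} {x b : A i} (h : P i x b) (hb : cellProb P q i b ≠ 0) :
    smoothing P q i x b = actionProb q i b / cellProb P q i b := by
  classical
  rw [smoothing, dif_pos ⟨actionProb_nonneg hq i, by
    rw [cellProb_congr P q h]
    exact lt_of_le_of_ne (cellProb_nonneg hq i b) hb.symm⟩]
  change (if P i x b then actionProb q i b else 0) / cellProb P q i x = _
  rw [if_pos h, cellProb_congr P q h]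

lemma rel_mem_suppAct {q : (∀ j, A j) × Θ → ℝ} {i : I} {x b : A i}
    (h : inducedPartition q i x b) : x ∈ suppAct q i ↔ b ∈ suppAct q i := by
  rcases h with ⟨hx, hb, -⟩ | ⟨hx, hb⟩
  exacts [⟨fun _ => hb, fun _ => hx⟩, ⟨fun h => absurd h hx, fun h => absurd h hb⟩]

lemma cellProb_pos {P : ProductPartition A} {q : (∀ j, A j) × Θ → ℝ} (hq : ∀ aθ, 0 ≤ q aθ) {i : I}
    {x : A i} (hx : x ∈ suppAct q i) : 0 < cellProb P q i x :=
  lt_of_lt_of_le hx (actionProb_le_cellProb hq ((P i).refl x))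

/-- The law of the redrawn action depends only on the cell, and within it is proportional to `q`. -/
lemma smoothing_proportional {q : (∀ j, A j) × Θ → ℝ} (hq : ∀ aθ, 0 ≤ q aθ) {i : I}
    {x x' : A i} (hx : x ∈ suppAct q i) (hx' : x' ∈ suppAct q i) (h : cond q i x = cond q i x')
    (y : A i) : smoothing (inducedPartition q) q i y x * actionProb q i x' =
      smoothing (inducedPartition q) q i y x' * actionProb q i x := by
  have hxx : inducedPartition q i x x' := Or.inl ⟨hx, hx', h⟩
  by_cases hy : inducedPartition q i y x
  · have hy' : inducedPartition q i y x' := (inducedPartition q i).trans hy hxx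
    rw [smoothing_of_rel hq hy (cellProb_pos hq hx).ne',
      smoothing_of_rel hq hy' (cellProb_pos hq hx').ne', cellProb_congr _ q hxx]
    ring
  · have hy' : ¬ inducedPartition q i y x' := fun hy' =>
      hy ((inducedPartition q i).trans hy' ((inducedPartition q i).symm hxx))
    rw [smoothing_of_not_rel _ q hy, smoothing_of_not_rel _ q hy', zero_mul, zero_mul]

lemma combine_update (i : I) (a : ∀ j, A j) (x : A i) :
    combine i x (fun j => a j) = Function.update a i x := by
  funext j
  by_cases h : j = i
  · subst h
    simp
  · rw [Function.update_of_ne h]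
    exact combine_coe i x (fun j => a j) ⟨j, h⟩

/-- Equal conditionals allow one coordinate to be exchanged at the price of the ratio of its action
probabilities. Exchanging the coordinates one by one gives the product. -/
lemma mul_prod_actionProb_comm {q : (∀ j, A j) × Θ → ℝ} (θ : Θ) (a a' : ∀ j, A j)
    (h : ∀ i, a i ∈ suppAct q i ∧ a' i ∈ suppAct q i ∧ cond q i (a' i) = cond q i (a i)) :
    q (a', θ) * ∏ i, actionProb q i (a i) = q (a, θ) * ∏ i, actionProb q i (a' i) := by
  have key : ∀ (S : Finset I) (a' : ∀ j, A j), (∀ i ∉ S, a' i = a i) →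
      (∀ i, a i ∈ suppAct q i ∧ a' i ∈ suppAct q i ∧ cond q i (a' i) = cond q i (a i)) →
      q (a', θ) * ∏ i, actionProb q i (a i) = q (a, θ) * ∏ i, actionProb q i (a' i) := by
    intro S
    induction S using Finset.induction_on with
    | empty =>
      intro a' ha' _
      rw [show a' = a from funext fun i => ha' i (Finset.notMem_empty i)]
    | insert i S hi ih =>
      intro a' ha' hs
      have h1 := ih (Function.update a' i (a i)) (fun j hj => by
        by_cases hji : j = i
        · subst hji
          rw [Function.update_self]
        · rw [Function.update_of_ne hji]
          exact ha' j (by simp [hji, hj])) fun j => by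
        by_cases hji : j = i
        · subst hji
          rw [Function.update_self]
          exact ⟨(hs j).1, (hs j).1, rfl⟩
        · rw [Function.update_of_ne hji]
          exact hs j
      have h2 := (cond_eq_cond_iff (hs i).2.1 (hs i).1).1 (hs i).2.2 (fun j => a' j) θ
      rw [combine_update, combine_update, Function.update_eq_self] at h2
      have hpos : 0 < actionProb q i (a i) := (hs i).1
      rw [← Finset.mul_prod_erase _ (fun j => actionProb q j (Function.update a' i (a i) j))
        (Finset.mem_univ i), Function.update_self] at h1
      have h3 : ∏ j ∈ Finset.univ.erase i, actionProb q j (Function.update a' i (a i) j) =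
          ∏ j ∈ Finset.univ.erase i, actionProb q j (a' j) :=
        Finset.prod_congr rfl fun j hj => by
          rw [Function.update_of_ne (Finset.ne_of_mem_erase hj)]
      rw [h3] at h1
      rw [← Finset.mul_prod_erase _ (fun j => actionProb q j (a' j)) (Finset.mem_univ i)]
      refine mul_right_cancel₀ hpos.ne' ?_
      linear_combination (∏ j, actionProb q j (a j)) * h2 + actionProb q i (a' i) * h1
  exact key Finset.univ a' (fun i hi => absurd (Finset.mem_univ i) hi) h

/-- Detailed balance. Profiles in different cells do not communicate, profiles outside the support
have probability zero, and otherwise both transition products are divided by the same cell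
probabilities. -/
lemma smoothing_reversible {q : (∀ j, A j) × Θ → ℝ} (hq : ∀ aθ, 0 ≤ q aθ) (θ : Θ)
    (a a' : ∀ j, A j) :
    q (a', θ) * ∏ i, smoothing (inducedPartition q) q i (a' i) (a i) =
      q (a, θ) * ∏ i, smoothing (inducedPartition q) q i (a i) (a' i) := by
  set R := inducedPartition q
  by_cases hrel : ∀ i, R i (a i) (a' i)
  · by_cases hs : ∀ i, a i ∈ suppAct q i
    · have hs' : ∀ i, a' i ∈ suppAct q i := fun i => (rel_mem_suppAct (hrel i)).1 (hs i)
      have h := mul_prod_actionProb_comm θ a a' fun i => ⟨hs i, hs' i, by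
        rcases hrel i with ⟨-, -, h⟩ | ⟨h, -⟩
        exacts [h.symm, absurd (hs i) h]⟩
      have e1 : ∏ i, smoothing R q i (a' i) (a i) =
          (∏ i, actionProb q i (a i)) / ∏ i, cellProb R q i (a i) := by
        rw [← Finset.prod_div_distrib]
        exact Finset.prod_congr rfl fun i _ =>
          smoothing_of_rel hq ((R i).symm (hrel i)) (cellProb_pos hq (hs i)).ne'
      have e2 : ∏ i, smoothing R q i (a i) (a' i) =
          (∏ i, actionProb q i (a' i)) / ∏ i, cellProb R q i (a i) := by
        rw [← Finset.prod_div_distrib]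
        exact Finset.prod_congr rfl fun i _ => by
          rw [smoothing_of_rel hq (hrel i) (cellProb_pos hq (hs' i)).ne', cellProb_congr R q (hrel i)]
      rw [e1, e2, ← mul_div_assoc, ← mul_div_assoc, h]
    · rw [not_forall] at hs
      obtain ⟨i, hi⟩ := hs
      have hi' : a' i ∉ suppAct q i := mt (rel_mem_suppAct (hrel i)).2 hi
      have h0 : q (a, θ) = 0 :=
        le_antisymm ((le_actionProb hq i a θ).trans_eq (eq_zero_of_notMem_suppAct hq hi)) (hq _)
      have h0' : q (a', θ) = 0 :=
        le_antisymm ((le_actionProb hq i a' θ).trans_eq (eq_zero_of_notMem_suppAct hq hi')) (hq _)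
      rw [h0, h0', zero_mul, zero_mul]
  · rw [not_forall] at hrel
    obtain ⟨i, hi⟩ := hrel
    rw [Finset.prod_eq_zero (Finset.mem_univ i)
        (smoothing_of_not_rel R q fun h => hi ((R i).symm h)),
      Finset.prod_eq_zero (Finset.mem_univ i) (smoothing_of_not_rel R q hi), mul_zero, mul_zero]

/-- Redrawing actions within the cells induced by `q` leaves `q` unchanged. -/
lemma sum_mul_prod_smoothing {q : (∀ j, A j) × Θ → ℝ} (hq : ∀ aθ, 0 ≤ q aθ) (θ : Θ)
    (a : ∀ j, A j) :
    ∑ a', q (a', θ) * ∏ i, smoothing (inducedPartition q) q i (a' i) (a i) = q (a, θ) := by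
  simp_rw [fun a' => smoothing_reversible hq θ a a']
  rw [← Finset.mul_sum, sum_prod_profile fun i => smoothing (inducedPartition q) q i (a i), mul_one]

lemma continuous_actionProb (i : I) (x : A i) :
    Continuous fun q : (∀ j, A j) × Θ → ℝ => actionProb q i x := by
  unfold actionProb
  fun_prop

lemma continuous_cellProb (P : ProductPartition A) (i : I) (x : A i) :
    Continuous fun q : (∀ j, A j) × Θ → ℝ => cellProb P q i x := by
  classical
  refine continuous_finsetSum _ fun b _ => ?_
  split_ifs
  exacts [continuous_actionProb i b, continuous_const]

/-! ### Decomposing outcomes close to a mixture of Nash equilibria. -/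

namespace BaseGame

variable {G : BaseGame I Θ A}

/-- Being proportional to `p` within cells, `β` is fixed by redrawing according to `p`. The kernel
may fail to converge only on cells of `p`-probability zero, where `β` has no mass. -/
lemma tendsto_mix_smoothing {P : ProductPartition A} {p : (∀ j, A j) × Θ → ℝ}
    (hp : ∀ aθ, 0 ≤ p aθ) {q : ℕ → (∀ j, A j) × Θ → ℝ} (hq : ∀ n aθ, 0 ≤ q n aθ)
    (hlim : Filter.Tendsto q Filter.atTop (𝓝 p)) {i : I} (β : stdSimplex ℝ (A i))
    (hβ : ∀ x x', P i x x' → β x * actionProb p i x' = β x' * actionProb p i x)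
    (hβ0 : ∀ x, actionProb p i x = 0 → β x = 0) (b : A i) :
    Filter.Tendsto (fun n => mix β (smoothing P (q n) i) b) Filter.atTop (𝓝 (β b)) := by
  classical
  simp_rw [mix_apply]
  have hcell : Filter.Tendsto (fun n => cellProb P (q n) i b) Filter.atTop
      (𝓝 (cellProb P p i b)) := ((continuous_cellProb P i b).tendsto p).comp hlim
  have hact : Filter.Tendsto (fun n => actionProb (q n) i b) Filter.atTop
      (𝓝 (actionProb p i b)) := ((continuous_actionProb i b).tendsto p).comp hlim
  rcases (cellProb_nonneg (P := P) hp i b).eq_or_lt with h0 | h0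
  · have hz : ∀ x, P i b x → β x = 0 := fun x hx => hβ0 x (le_antisymm
      ((actionProb_le_cellProb hp hx).trans_eq h0.symm) (actionProb_nonneg hp i x))
    rw [hz b ((P i).refl b)]
    refine tendsto_const_nhds.congr fun n => (Finset.sum_eq_zero fun x _ => ?_).symm
    by_cases hx : P i x b
    · rw [hz x ((P i).symm hx), mul_zero]
    · rw [smoothing_of_not_rel P _ hx, zero_mul]
  · have hsum : β b = ∑ x, (if P i b x then actionProb p i b / cellProb P p i b else 0) * β x := by
      have h1 : ∀ x, (if P i b x then actionProb p i b / cellProb P p i b else 0) * β x =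
          β b / cellProb P p i b * (if P i b x then actionProb p i x else 0) := by
        intro x
        split_ifs with hx
        · have := hβ x b ((P i).symm hx)
          rw [div_mul_eq_mul_div, div_mul_eq_mul_div, mul_comm, this]
        · rw [zero_mul, mul_zero]
      simp_rw [h1]
      rw [← Finset.mul_sum]
      exact (div_mul_cancel₀ _ h0.ne').symm
    rw [hsum]
    refine tendsto_finsetSum _ fun x _ => Filter.Tendsto.mul_const _ ?_
    split_ifs with hx
    · refine (hact.div hcell h0.ne').congr' ?_
      filter_upwards [hcell.eventually_ne h0.ne'] with n hn
      exact (smoothing_of_rel (hq n) ((P i).symm hx) hn).symm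
    · refine tendsto_const_nhds.congr fun n => ?_
      exact (smoothing_of_not_rel P _ fun h => hx ((P i).symm h)).symm

/-- Action profiles live in arbitrary universes; this moves the correlation states to `Fin`, hence
to the `Type` required by `Technology`. -/
lemma IsDecomposition.reindex {Z Z' : Type*} [Fintype Z] [Fintype Z'] {q : (∀ j, A j) × Θ → ℝ}
    {η : ℝ} {ζ : Θ → stdSimplex ℝ Z} {α : Z → Θ → ∀ j, stdSimplex ℝ (A j)}
    (h : G.IsDecomposition q η ζ α) (e : Z' ≃ Z) :
    G.IsDecomposition q η
      (fun θ => (⟨fun z => ζ θ (e z), fun z => stdSimplex.zero_le _ _, by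
        rw [e.sum_comp fun z => ζ θ z, stdSimplex.sum_eq_one]⟩ : stdSimplex ℝ Z'))
      fun z => α (e z) where
  outcome a θ := by
    rw [h.outcome]
    exact (e.sum_comp fun z => ζ θ z * G.prior θ * ∏ j, α z θ j (a j)).symm
  proportional i x hx x' hx' hc z θ hz := h.proportional i x hx x' hx' hc (e z) θ hz
  regret_le i := by
    refine le_trans (le_of_eq ?_) (h.regret_le i)
    exact e.sum_comp fun z => ∑ θ, ζ θ z * G.prior θ * G.regret i (fun j => α z θ j) θ

variable (G) in
lemma exists_regret_le : ∃ B : ℝ, 0 ≤ B ∧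
    ∀ (i : I) (θ : Θ) (α : ∀ j, stdSimplex ℝ (A j)), G.regret i (fun j => α j) θ ≤ B := by
  have hbdd : ∀ i θ, ∃ B, ∀ α : ∀ j, stdSimplex ℝ (A j), G.regret i (fun j => α j) θ ≤ B := by
    intro i θ
    have hc : Continuous fun α : ∀ j, stdSimplex ℝ (A j) => G.regret i (fun j => α j) θ :=
      (G.continuous_regret i θ).comp (continuous_pi fun j =>
        continuous_subtype_val.comp (continuous_apply j))
    obtain ⟨B, hB⟩ := (isCompact_range hc).bddAbove
    exact ⟨B, fun α => hB ⟨α, rfl⟩⟩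
  choose B hB using hbdd
  refine ⟨∑ i, ∑ θ, |B i θ|, Finset.sum_nonneg fun i _ => Finset.sum_nonneg fun θ _ =>
    abs_nonneg _, fun i θ α => (hB i θ α).trans ((le_abs_self _).trans ?_)⟩
  exact (Finset.single_le_sum (f := fun θ => |B i θ|) (fun _ _ => abs_nonneg _)
    (Finset.mem_univ θ)).trans (Finset.single_le_sum (f := fun i => ∑ θ, |B i θ|)
      (fun _ _ => Finset.sum_nonneg fun _ _ => abs_nonneg _) (Finset.mem_univ i))

/-- Outcomes close to a mixture of complete-information Nash equilibria decompose with small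
losses. -/
lemma IsNashMixture.eventually_isDecomposition {L : ℕ} {P : ProductPartition A}
    {p : (∀ j, A j) × Θ → ℝ} {s : Fin L → ℝ} {α : Fin L → Θ → ∀ j, stdSimplex ℝ (A j)}
    (h : G.IsNashMixture P p s α) {q : ℕ → (∀ j, A j) × Θ → ℝ} (hq : ∀ n, q n ∈ G.outcomes)
    (hP : ∀ n, inducedPartition (q n) = P) (hlim : Filter.Tendsto q Filter.atTop (𝓝 p)) {η : ℝ}
    (hη : 0 < η) : ∀ᶠ n in Filter.atTop, ∃ (Z : Type) (_ : Fintype Z) (ζ : Θ → stdSimplex ℝ Z)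
      (α : Z → Θ → ∀ j, stdSimplex ℝ (A j)), G.IsDecomposition (q n) η ζ α := by
  classical
  have hpmix : ∀ a θ, p (a, θ) = ∑ l, (⟨s, fun l => (h.pos l).le, h.sum_eq_one⟩ :
      stdSimplex ℝ (Fin L)) l * G.prior θ * ∏ j, α l θ j (a j) := fun a θ => by
    rw [h.eq_sum]
    exact Finset.sum_congr rfl fun l _ => (mul_assoc _ _ _).symm
  have hp := mem_outcomes_of_mixture (ζ := fun _ => ⟨s, fun l => (h.pos l).le, h.sum_eq_one⟩) hpmix
  have hα0 : ∀ l θ i x, actionProb p i x = 0 → α l θ i x = 0 := by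
    intro l θ i x hx
    rw [actionProb_of_mixture (ζ := fun _ => ⟨s, fun l => (h.pos l).le, h.sum_eq_one⟩) hpmix] at hx
    have hnn : ∀ l θ, 0 ≤ s l * G.prior θ * α l θ i x := fun l θ =>
      mul_nonneg (mul_nonneg (h.pos l).le (G.prior_pos θ).le) (stdSimplex.zero_le _ _)
    have h1 := (Finset.sum_eq_zero_iff_of_nonneg fun l _ => Finset.sum_nonneg fun θ _ =>
      hnn l θ).1 hx l (Finset.mem_univ l)
    have h2 := (Finset.sum_eq_zero_iff_of_nonneg fun θ _ => hnn l θ).1 h1 θ (Finset.mem_univ θ)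
    exact (mul_eq_zero.1 h2).resolve_left (mul_pos (h.pos l) (G.prior_pos θ)).ne'
  let αs : ℕ → Fin L → Θ → ∀ j, stdSimplex ℝ (A j) := fun n l θ j =>
    mix (α l θ j) (smoothing P (q n) j)
  have hreg : ∀ i, Filter.Tendsto
      (fun n => ∑ l, ∑ θ, s l * G.prior θ * G.regret i (fun j => αs n l θ j) θ)
      Filter.atTop (𝓝 0) := by
    intro i
    have h0 : (0 : ℝ) = ∑ l, ∑ θ, s l * G.prior θ * G.regret i (fun j => α l θ j) θ := by
      simp [h.regret_eq_zero]
    rw [h0]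
    refine tendsto_finsetSum _ fun l _ => tendsto_finsetSum _ fun θ _ =>
      Filter.Tendsto.const_mul _ (((G.continuous_regret i θ).tendsto _).comp ?_)
    rw [tendsto_pi_nhds]
    intro j
    rw [tendsto_pi_nhds]
    exact fun b => tendsto_mix_smoothing hp.1.1 (fun n => (hq n).1.1) hlim (α l θ j)
      (h.proportional l θ j) (hα0 l θ j) b
  obtain ⟨B, hB0, hB⟩ := G.exists_regret_le
  -- The remainder has total mass `δ` and regret at most `B`, so it costs at most half of `η`; the
  -- smoothed Nash part gets the other half.
  obtain ⟨δ, hδ0, hδ1, hδB⟩ : ∃ δ : ℝ, 0 < δ ∧ δ < 1 ∧ δ * B ≤ η / 2 := by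
    refine ⟨min (1 / 2) (η / 2 / (B + 1)), lt_min (by norm_num) (by positivity),
      (min_le_left _ _).trans_lt (by norm_num), ?_⟩
    calc _ ≤ η / 2 / (B + 1) * (B + 1) :=
          mul_le_mul (min_le_right _ _) (by linarith) hB0 (by positivity)
      _ = _ := div_mul_cancel₀ _ (by positivity)
  -- This makes the remainder nonnegative. The factor `1 - δ` leaves room where `p` is positive, and
  -- elsewhere nothing is needed.
  have hle : ∀ᶠ n in Filter.atTop, ∀ aθ, (1 - δ) * p aθ ≤ q n aθ := by
    rw [Filter.eventually_all]
    intro aθ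
    rcases (hp.1.1 aθ).eq_or_lt with h0 | h0
    · refine Filter.Eventually.of_forall fun n => ?_
      rw [← h0, mul_zero]
      exact (hq n).1.1 aθ
    · have ht := (tendsto_pi_nhds.1 hlim aθ).eventually_const_lt
        (show (1 - δ) * p aθ < p aθ by nlinarith)
      exact ht.mono fun n hn => hn.le
  have hregle : ∀ᶠ n in Filter.atTop, ∀ i,
      ∑ l, ∑ θ, s l * G.prior θ * G.regret i (fun j => αs n l θ j) θ < η / 2 := by
    rw [Filter.eventually_all]
    exact fun i => (hreg i).eventually_lt_const (by linarith)
  filter_upwards [hle, hregle] with n hn hrn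
  have hq0 := (hq n).1.1
  -- The left summand selects a Nash component, the right one an action profile from the remainder;
  -- `γ` smooths both.
  let ζ : Θ → stdSimplex ℝ (Fin L ⊕ ∀ j, A j) := fun θ =>
    ⟨Sum.elim (fun l => (1 - δ) * s l) fun a => (q n (a, θ) - (1 - δ) * p (a, θ)) / G.prior θ, by
      rintro (l | a)
      · exact mul_nonneg (by linarith) (h.pos l).le
      · exact div_nonneg (sub_nonneg.2 (hn _)) (G.prior_pos θ).le, by
      rw [Fintype.sum_sum_type]
      simp only [Sum.elim_inl, Sum.elim_inr]
      rw [← Finset.mul_sum, h.sum_eq_one, ← Finset.sum_div, Finset.sum_sub_distrib,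
        ← Finset.mul_sum, (hq n).2, hp.2]
      field_simp [(G.prior_pos θ).ne']
      ring⟩
  have hζl : ∀ θ l, ζ θ (Sum.inl l) = (1 - δ) * s l := fun _ _ => rfl
  have hζr : ∀ θ a, ζ θ (Sum.inr a) * G.prior θ = q n (a, θ) - (1 - δ) * p (a, θ) := fun θ a =>
    div_mul_cancel₀ _ (G.prior_pos θ).ne'
  let γ : (Fin L ⊕ ∀ j, A j) → Θ → ∀ j, stdSimplex ℝ (A j) :=
    Sum.elim (αs n) fun a _ j => smoothing P (q n) j (a j)
  have hdec : G.IsDecomposition (q n) η ζ γ := by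
    refine ⟨fun a θ => ?_, fun i x hx x' hx' hc z θ _ => ?_, fun i => ?_⟩
    · rw [Fintype.sum_sum_type]
      simp only [hζl, hζr, γ, Sum.elim_inl, Sum.elim_inr]
      have h1 : ∀ l, ∏ j, αs n l θ j (a j) =
          ∑ a' : ∀ j, A j, (∏ j, α l θ j (a' j)) * ∏ j, smoothing P (q n) j (a' j) (a j) := by
        intro l
        simp only [αs]
        rw [← sum_prod_mix]
        refine Finset.sum_congr rfl fun a' _ => ?_
        rw [← Finset.prod_mul_distrib]
        exact Finset.prod_congr rfl fun j _ => mul_comm _ _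
      have h2 : ∑ l, (1 - δ) * s l * G.prior θ * ∏ j, αs n l θ j (a j) =
          ∑ a' : ∀ j, A j, (1 - δ) * p (a', θ) * ∏ j, smoothing P (q n) j (a' j) (a j) := by
        simp_rw [h1, h.eq_sum, Finset.mul_sum, Finset.sum_mul]
        rw [Finset.sum_comm]
        exact Finset.sum_congr rfl fun a' _ => Finset.sum_congr rfl fun l _ => by ring
      rw [h2, ← Finset.sum_add_distrib]
      -- Before smoothing the total is exactly `q n`, which is invariant under smoothing.
      conv_lhs => rw [← sum_mul_prod_smoothing hq0 θ a, hP n]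
      exact Finset.sum_congr rfl fun a' _ => by ring
    · have hsm := smoothing_proportional hq0 hx hx' hc
      rw [hP n] at hsm
      rcases z with l | a
      · simp only [γ, Sum.elim_inl, αs, mix_apply, Finset.sum_mul]
        refine Finset.sum_congr rfl fun y _ => ?_
        linear_combination (α l θ i y) * hsm y
      · exact hsm (a i)
    · rw [Fintype.sum_sum_type]
      simp only [hζl, hζr, γ, Sum.elim_inl, Sum.elim_inr]
      have h1 : ∑ l, ∑ θ, (1 - δ) * s l * G.prior θ * G.regret i (fun j => αs n l θ j) θ ≤
          ∑ l, ∑ θ, s l * G.prior θ * G.regret i (fun j => αs n l θ j) θ := by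
        refine Finset.sum_le_sum fun l _ => Finset.sum_le_sum fun θ _ => ?_
        have hnn : 0 ≤ s l * G.prior θ * G.regret i (fun j => αs n l θ j) θ :=
          mul_nonneg (mul_nonneg (h.pos l).le (G.prior_pos θ).le) (G.regret_nonneg i _ θ)
        rw [mul_assoc, mul_assoc, ← mul_assoc (s l)]
        exact mul_le_of_le_one_left hnn (by linarith)
      have h2 : ∑ a : ∀ j, A j, ∑ θ, (q n (a, θ) - (1 - δ) * p (a, θ)) *
          G.regret i (fun j => smoothing P (q n) j (a j)) θ ≤ δ * B := by
        calc _ ≤ ∑ a : ∀ j, A j, ∑ θ, (q n (a, θ) - (1 - δ) * p (a, θ)) * B :=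
              Finset.sum_le_sum fun a _ => Finset.sum_le_sum fun θ _ =>
                mul_le_mul_of_nonneg_left (hB i θ _) (sub_nonneg.2 (hn _))
          _ = δ * B := by
              rw [Finset.sum_comm]
              simp_rw [← Finset.sum_mul, Finset.sum_sub_distrib, ← Finset.mul_sum, (hq n).2, hp.2,
                G.prior_sum]
              ring
      linarith [hrn i]
  exact ⟨_, inferInstance, _, _, hdec.reindex (Fintype.equivFin _).symm⟩

end BaseGame

end InfoGame

end

/-! ### The characterization of vanishing cost equilibria. -/

theorem theorem6 {I : Type*} {Θ : Type*} {A : I → Type*}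
    [Fintype I] [DecidableEq I] [Fintype Θ] [∀ i, Fintype (A i)]
    (G : InfoGame.BaseGame I Θ A) (p : (∀ i, A i) × Θ → ℝ) (hp : p ∈ G.outcomes) :
    G.IsVanishingCostEquilibrium p ↔
      ∃ P : InfoGame.ProductPartition A,
        (∃ (L : ℕ) (s : Fin L → ℝ) (q : Fin L → (∀ i, A i) × Θ → ℝ),
          (∀ l, 0 ≤ s l) ∧ ∑ l, s l = 1 ∧
          (∀ l, G.IsCompleteInfoNash (q l) ∧ InfoGame.IsDecomposable P p (q l)) ∧
          p = ∑ l, s l • q l) ∧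
        (∃ pn : ℕ → (∀ i, A i) × Θ → ℝ,
          (∀ n, G.IsSeparatedBCE (pn n) ∧ InfoGame.inducedPartition (pn n) = P) ∧
          Filter.Tendsto pn Filter.atTop (𝓝 p)) := by
  classical
  constructor
  · rintro ⟨-, h⟩
    choose T hT ξ σ heq hcost hclose using fun n : ℕ => h (1 / ((n : ℝ) + 1)) (by positivity)
    have hlim : Filter.Tendsto (fun n => InfoGame.outcomeOf G (T n) (ξ n) (σ n)) Filter.atTop
        (𝓝 p) := by
      rw [tendsto_pi_nhds]
      rintro ⟨a, θ⟩
      rw [tendsto_iff_dist_tendsto_zero]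
      refine squeeze_zero (fun _ => dist_nonneg) (fun n => ?_) tendsto_one_div_add_atTop_nhds_zero_nat
      rw [dist_comm, Real.dist_eq]
      exact hclose n a θ
    have hfin : ∀ i, Finite (Setoid (A i)) := fun i =>
      Finite.of_injective (fun (S : Setoid (A i)) (x y : A i) => S x y) fun S S' h =>
        Setoid.ext fun x y => iff_of_eq (congrFun (congrFun h x) y)
    have : Finite (InfoGame.ProductPartition A) := inferInstanceAs (Finite (∀ i, Setoid (A i)))
    -- Pigeonhole over the finitely many product partitions gives a subsequence with a constant
    -- induced partition.
    obtain ⟨P, hP⟩ := Finite.exists_infinite_fiber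
      fun n => InfoGame.inducedPartition (InfoGame.outcomeOf G (T n) (ξ n) (σ n))
    obtain ⟨φ, hφ, hφP⟩ := Filter.extraction_of_frequently_atTop
      (Nat.frequently_atTop_iff_infinite.2 (Set.infinite_coe_iff.1 hP))
    refine ⟨P, ?_, fun n => InfoGame.outcomeOf G (T (φ n)) (ξ (φ n)) (σ (φ n)),
      fun n => ⟨(heq (φ n)).isSeparatedBCE (hT (φ n)), hφP n⟩, hlim.comp hφ.tendsto_atTop⟩
    obtain ⟨L, s, α, hmix⟩ := InfoGame.BaseGame.exists_isNashMixture_of_tendsto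
      (tendsto_one_div_add_atTop_nhds_zero_nat.comp hφ.tendsto_atTop)
      (fun n => ⟨_, inferInstance, _, _, (heq (φ n)).isDecomposition (hT (φ n)) (hcost (φ n))⟩)
      hφP (hlim.comp hφ.tendsto_atTop)
    exact hmix.exists_decomposable
  · rintro ⟨P, ⟨L, s, q, hs, hs1, hq, hpq⟩, pn, hpn, hlim⟩
    obtain ⟨L, s, α, hmix⟩ := InfoGame.BaseGame.exists_isNashMixture hs hs1 hq hpq
    refine ⟨hp, fun ε hε => ?_⟩
    have hclose : ∀ᶠ n in Filter.atTop, ∀ aθ, |p aθ - pn n aθ| ≤ ε := by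
      rw [Filter.eventually_all]
      intro aθ
      have := (Metric.tendsto_nhds.1 (tendsto_pi_nhds.1 hlim aθ)) ε hε
      exact this.mono fun n hn => by
        rw [← Real.dist_eq, dist_comm]
        exact hn.le
    -- Regret is held to `ε / 2` because supporting costs bounded by `ε` need strict slack.
    obtain ⟨n, ⟨Z, _, ζ, α', hdec⟩, hn⟩ := ((hmix.eventually_isDecomposition
      (fun n => (hpn n).1.1.1) (fun n => (hpn n).2) hlim (half_pos hε)).and hclose).exists
    obtain ⟨T, hT, ξ, σ, heq, hcost, hout⟩ := hdec.exists_technology (hpn n).1 (half_lt_self hε)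
    refine ⟨T, hT, ξ, σ, heq, hcost, fun a θ => ?_⟩
    rw [hout]
    exact hn (a, θ)
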